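/- **Trees and sources.** An ordinal tree is a rooted ordered tree: a root with a possibly empty sequence of ordinal subtrees. $\mathfrak T$ is the set of ordinal trees, $\mathfrak T_n$ the set of those with $n$ nodes, $|t|$ the number of nodes of $t$, and $\lg=\log_2$. A *fixed-size ordinal source* is a function $p$ from finite (possibly empty) sequences of positive integers to $[0,1]$ such that for every $m\ge 0$ the values $p(n_1,\dots,n_k)$ over all compositions $n_1+\dots+n_k=m$ sum to $1$ (so $p()=1$). It gives each tree the probability $\mathbb P[t]=\prod_{v} p(n_1(v),\dots,n_{\deg v}(v))$, where $v$ ranges over the nodes of $t$ and $n_i(v)$ is the size of the subtree rooted at the $i$th child of $v$. The source is *monotonic* if, for all sequences of positive integers, 1. $p(\dots,n_i,\dots)\ge p(\dots,n_i+1,\dots)$; 2. $p(n_1,\dots,n_i,n_{i+1},\dots,n_k)\ge p(n_1,\dots,n_i,1,n_{i+1},\dots,n_k)$; 3. $p(n_1,\dots,n_k)\le p(n_1,\dots,n_i)\,p(n_{i+1},\dots,n_k)$. **Tree covering.** For a parameter $B$ a node is *heavy* if its subtree has at least $B$ nodes. The Farzan–Munro algorithm works bottom-up. Each node $v$ returns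 either one *active* component with root $v$, or only *permanent* components with root $v$. To *pack greedily* means to start a component $\{v\}$, to add the active components of children of $v$ from left to right, and, once the component has at least $B$ nodes, to declare it permanent and to start a new component $\{v\}$ if something remains to be packed. - If $v$ has at most one heavy child, all active components of children are packed greedily; a heavy child whose components are already permanent is skipped, and packing continues across it. If this gives a single component with fewer than $B$ nodes, it stays active; otherwise all resulting components become permanent. - If $v$ has at least two heavy children, the components of the heavy children become permanent, the light children in each nonempty gap before, between and after the heavy children are packed greedily and separately (if there are no light children, the component $\{v\}$ is formed), and all components become permanent. At the root of the tree everything is made permanent. The permanent components are the *micro trees*; they overlap only in shared roots, and each has at most one *external edge*, i.e. edge to a missing child that is not a root child preceding, or following, all root children inside the micro tree. **Top tier.** The top tier $\Upsilon$ is the ordinal tree whose nodes are the micro trees and one additional dummy root. The micro trees containing the root of $t$ are the children of the dummy root. A micro tree whose root $u$ has parent $v$ in $t$ is a child of the micro tree containing $v$, if that is unique. If $v$ is shared by several micro trees, it is a child of the one across whose root children $u$ is skipped, if there is one, otherwise of the last of them that contains a child of $v$ to the left of $u$, otherwise of the first of them. The edge to a child micro tree has one of five types: new or continued leftmost root child (its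 root precedes all root children inside the parent micro tree), new or continued rightmost root child (its root follows all of them), or external; "continued" means that the child shares its root with the child immediately before it. **The code.** The *hypersuccinct code* $\mathsf H:\mathfrak T\to\{0,1\}^\star$ is defined as follows. For $t\in\mathfrak T_n$ let $\mu_1,\dots,\mu_m$ be the micro trees for $B=\lceil\frac18\lg n\rceil$ in depth-first order of $\Upsilon$, put $\mu=\lceil\frac14\lg n\rceil$, let $\gamma$ be the Elias gamma code and $BP$ the balanced-parenthesis encoding, and let $C$ be the Huffman code of the string of shapes $\mu_1\cdots\mu_m$. For a shape $s$ let $\bar C(s)=0\cdot\gamma(|s|+1)\cdot BP(s)$ if $|C(s)|>2|s|+2\lfloor\lg(|s|+1)\rfloor$, and $\bar C(s)=1\cdot C(s)$ otherwise. Then $\mathsf H(t)$ is the concatenation of 1. $\gamma(n)\,\gamma(m)$; 2. $BP(\Upsilon)$; 3. a table of all occurring shapes $s$ and their codewords: $\gamma$ of the number of entries, then $\gamma(|\bar C(s)|)\,\bar C(s)\,\gamma(|s|)\,BP(s)$ for each entry; 4. $\bar C(\mu_1)\cdots\bar C(\mu_m)$; 5. for each $\mu_i$, the place of its external edge: the preorder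 rank in $\mu_i$ of the node it leaves and the child rank at which it is inserted, in $\lceil\lg(\mu+1)\rceil$ bits each (zeros if there is no external edge); 6. for each $\mu_i$, the type of its edge from its parent in $\Upsilon$, in $3$ bits. **Theorem (universality for monotonic sources, ordinal trees).** There is a function $r:\mathbb N\to\mathbb R$ with $r(n)=O\!\left(\frac{n\log\log n}{\log n}\right)$ as $n\to\infty$, independent of the source, such that for every monotonic fixed-size ordinal source $p$, every $n$, and every $t\in\mathfrak T_n$ with $\mathbb P[t]>0$, $$|\mathsf H(t)|\le\lg\frac1{\mathbb P[t]}+r(n).$$ In particular, the following two functions are monotonic fixed-size ordinal sources that give every tree positive probability, so that the bound holds for every $t\in\mathfrak T_n$: - *uniform composition trees*, $p(n_1,\dots,n_k)=2^{-(n_1+\dots+n_k-1)}$ for $k\ge1$ and $p()=1$; - *random LRM-trees*, $p(n_1,\dots,n_k)=\prod_{j=1}^k\frac1{n_1+\dots+n_j}$. -/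

import Mathlib

namespace Hypersuccinct

/-! ## Ordinal trees -/

/-- Ordinal (plane, ordered) trees: a root with a possibly empty sequence of subtrees. -/
inductive OrdTree : Type
  | node : List OrdTree → OrdTree

namespace OrdTree

mutual
/-- Equality of trees is decidable. -/
def decEq : (s t : OrdTree) → Decidable (s = t)
  | node cs, node ds =>
      match decEqForest cs ds with
      | isTrue h => isTrue (congrArg node h)
      | isFalse h => isFalse fun e => h (OrdTree.node.inj e)
/-- Equality of sequences of trees is decidable. -/
def decEqForest : (ss ts : List OrdTree) → Decidable (ss = ts)
  | [], [] => isTrue rfl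
  | [], _ :: _ => isFalse nofun
  | _ :: _, [] => isFalse nofun
  | s :: ss, t :: ts =>
      match decEq s t, decEqForest ss ts with
      | isTrue h, isTrue k => isTrue (h ▸ k ▸ rfl)
      | isFalse h, _ => isFalse fun e => h (List.cons.inj e).1
      | _, isFalse k => isFalse fun e => k (List.cons.inj e).2
end

instance : DecidableEq OrdTree := decEq

mutual
/-- The number of nodes of a tree. -/
def size : OrdTree → ℕ
  | node cs => 1 + sizeForest cs
/-- The total number of nodes of a sequence of trees. -/
def sizeForest : List OrdTree → ℕ
  | [] => 0
  | t :: ts => size t + sizeForest ts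
end

/-- The number of children of the root. -/
def rootDegree : OrdTree → ℕ
  | node cs => cs.length

mutual
/-- Balanced-parenthesis encoding; an opening parenthesis is `true`, a closing one `false`. -/
def bp : OrdTree → List Bool
  | node cs => true :: (bpForest cs ++ [false])
/-- Balanced-parenthesis encoding of a sequence of trees. -/
def bpForest : List OrdTree → List Bool
  | [] => []
  | t :: ts => bp t ++ bpForest ts
end

end OrdTree

/-! ## Fixed-size ordinal tree sources -/

/-- `p` assigns a probability to every finite sequence of positive integers such that the
probabilities of all compositions of `m` sum to `1`, for every `m ≥ 0`.
(Values of `p` at lists that contain a zero play no role.) -/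
structure IsFixedSizeSource (p : List ℕ → ℝ) : Prop where
  nonneg : ∀ l : List ℕ, (∀ x ∈ l, 0 < x) → 0 ≤ p l
  le_one : ∀ l : List ℕ, (∀ x ∈ l, 0 < x) → p l ≤ 1
  sum_eq_one : ∀ m : ℕ, ∑ c : Composition m, p c.blocks = 1

/-- Monotonic sources: nonincreasing in every component, nonincreasing upon insertion of a new
subtree of size one, and submultiplicative. -/
structure IsMonotonic (p : List ℕ → ℝ) : Prop where
  component : ∀ (a b : List ℕ) (m : ℕ), (∀ x ∈ a, 0 < x) → (∀ x ∈ b, 0 < x) → 0 < m →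
    p (a ++ (m + 1) :: b) ≤ p (a ++ m :: b)
  insert_one : ∀ a b : List ℕ, (∀ x ∈ a, 0 < x) → (∀ x ∈ b, 0 < x) →
    p (a ++ 1 :: b) ≤ p (a ++ b)
  submul : ∀ a b : List ℕ, (∀ x ∈ a, 0 < x) → (∀ x ∈ b, 0 < x) →
    p (a ++ b) ≤ p a * p b

mutual
/-- The probability of a tree: the product over all nodes `v` of `p (n₁, …, n_k)`, where
`n₁, …, n_k` are the sizes of the subtrees rooted at the children of `v`. -/
def treeProb (p : List ℕ → ℝ) : OrdTree → ℝ
  | .node cs => p (cs.map OrdTree.size) * forestProb p cs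
/-- The product of the probabilities of the trees in a sequence. -/
def forestProb (p : List ℕ → ℝ) : List OrdTree → ℝ
  | [] => 1
  | t :: ts => treeProb p t * forestProb p ts
end

/-- Uniform composition trees: all `2 ^ (m - 1)` compositions of `m ≥ 1` are equally likely
(and the empty composition of `0` has probability `1`). -/
noncomputable def uniformComposition (l : List ℕ) : ℝ :=
  1 / 2 ^ (l.sum - 1)

/-- Random LRM-trees: `p (n₁, …, n_k) = ∏ j, 1 / (n₁ + ⋯ + n_j)`. -/
noncomputable def lrmSource (l : List ℕ) : ℝ :=
  ∏ j ∈ Finset.range l.length, 1 / ((l.take (j + 1)).sum : ℝ)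

/-! ## Integer codes -/

/-- Elias gamma code of `n ≥ 1`: `⌊lg n⌋` zeros, then `n` in binary, most significant bit first. -/
def eliasGamma (n : ℕ) : List Bool :=
  List.replicate (Nat.log 2 n) false ++ n.bits.reverse

/-- The `w` least significant bits of `x`, least significant bit first. -/
def fixedWidth (w x : ℕ) : List Bool :=
  (List.range w).map fun i => x.testBit i

/-! ## Huffman codes -/

/-- Code trees with symbols at the leaves. -/
inductive CodeTree (α : Type) : Type
  | leaf : α → CodeTree α
  | node : CodeTree α → CodeTree α → CodeTree α

/-- The symbols of a code tree with their codewords. -/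
def CodeTree.codewords {α : Type} : CodeTree α → List (α × List Bool)
  | .leaf a => [(a, [])]
  | .node l r =>
      (l.codewords.map fun e => (e.1, false :: e.2)) ++
        (r.codewords.map fun e => (e.1, true :: e.2))

/-- Insertion into a list of weighted code trees that is sorted by weight. -/
def insertByWeight {α : Type} (x : ℕ × CodeTree α) :
    List (ℕ × CodeTree α) → List (ℕ × CodeTree α)
  | [] => [x]
  | y :: ys => if x.1 ≤ y.1 then x :: y :: ys else y :: insertByWeight x ys

theorem length_insertByWeight {α : Type} (x : ℕ × CodeTree α) (l : List (ℕ × CodeTree α)) :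
    (insertByWeight x l).length = l.length + 1 := by
  induction l with
  | nil => rfl
  | cons y ys ih =>
    unfold insertByWeight
    split
    · rfl
    · simp [ih]

/-- The merging phase of the Huffman algorithm on a list sorted by weight: as long as there are
two trees, replace two of least weight by their join. -/
def huffmanMerge {α : Type} : List (ℕ × CodeTree α) → Option (CodeTree α)
  | [] => none
  | [x] => some x.2
  | x :: y :: zs => huffmanMerge (insertByWeight (x.1 + y.1, .node x.2 y.2) zs)
  termination_by l => l.length
  decreasing_by simp [length_insertByWeight]

/-- The Huffman tree of a string, with respect to the numbers of occurrences of its symbols. -/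
def huffmanTree {α : Type} [DecidableEq α] (s : List α) : Option (CodeTree α) :=
  huffmanMerge <| (s.dedup.map fun a => (s.count a, CodeTree.leaf a)).foldr insertByWeight []

/-- The Huffman codeword of the symbol `a` for the string `s`. -/
def huffmanCode {α : Type} [DecidableEq α] (s : List α) (a : α) : List Bool :=
  (((huffmanTree s).elim [] CodeTree.codewords).lookup a).getD []

/-- The length-restricted version of a code `C` for ordinal trees. -/
def lengthRestricted (C : OrdTree → List Bool) (t : OrdTree) : List Bool :=
  if (C t).length > 2 * t.size + 2 * Nat.log 2 (t.size + 1) then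
    false :: (eliasGamma (t.size + 1) ++ t.bp)
  else
    true :: C t

/-! ## Tree covering: the Farzan–Munro decomposition and the top tier -/

/-- The type of the edge that leads from a micro tree to a child micro tree in the top tier.
The root of the child is a child of the root of the parent and comes before (`leftmost`) or after
(`rightmost`) all children of that root inside the parent micro tree; or the edge is the external
edge. "New" marks the first of the micro trees that share their root, "continued" all others. -/
inductive EdgeType : Type
  | newLeftmost
  | continuedLeftmost
  | newRightmost
  | continuedRightmost
  | external

/-- The number of an edge type. -/
def EdgeType.toNat : EdgeType → ℕ
  | .newLeftmost => 0
  | .continuedLeftmost => 1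
  | .newRightmost => 2
  | .continuedRightmost => 3
  | .external => 4

/-- A node of the top tier: a micro tree with its shape, its portal (preorder rank of the
node with the external edge inside the micro tree, and child rank at which the external edge is
inserted), the type of its parent edge, and its children in the top tier. -/
inductive TopTree : Type
  | node (shape : OrdTree) (portal : ℕ × ℕ) (edge : EdgeType) (children : List TopTree) : TopTree

/-- Change the type of the parent edge. -/
def TopTree.withEdge (e : EdgeType) : TopTree → TopTree
  | .node s q _ cs => .node s q e cs

/-- Set the parent edges of the micro trees that share one root (listed from left to right). -/
def labelGroup (new continued : EdgeType) : List TopTree → List TopTree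
  | [] => []
  | c :: cs => c.withEdge new :: cs.map (TopTree.withEdge continued)

/-- A child `u` of a node of a component that is not itself in that component. -/
structure Attachment : Type where
  /-- Preorder rank (from `0`) of the parent of `u` inside the component. -/
  parent : ℕ
  /-- Number of children of this parent that are inside the component and to the left of `u`. -/
  rank : ℕ
  /-- The permanent components rooted at `u`, from left to right. -/
  group : List TopTree

/-- A component under construction: its shape and the subtrees missing from it. -/
structure Component : Type where
  shape : OrdTree
  attachments : List Attachment

/-- Whether an attachment lies before all children of the root inside the component. -/
def Attachment.isLeftmost (a : Attachment) : Bool :=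
  a.parent == 0 && a.rank == 0

/-- Whether an attachment lies after all children of the root inside the component. -/
def Attachment.isRightmost (s : OrdTree) (a : Attachment) : Bool :=
  a.parent == 0 && a.rank == s.rootDegree

/-- The components of an attachment, with the types of the edges that lead to them. -/
def Attachment.label (s : OrdTree) (a : Attachment) : List TopTree :=
  if a.isLeftmost then labelGroup .newLeftmost .continuedLeftmost a.group
  else if a.isRightmost s then labelGroup .newRightmost .continuedRightmost a.group
  else labelGroup .external .external a.group

/-- The portal of the external edge (`(0, 0)` if there is no external edge). -/
def Component.portal (c : Component) : ℕ × ℕ :=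
  match c.attachments.find? fun a => !a.isLeftmost && !a.isRightmost c.shape with
  | none => (0, 0)
  | some a => (a.parent, a.rank)

/-- Declare a component permanent: it becomes a micro tree. -/
def Component.toMicroTree (c : Component) : TopTree :=
  .node c.shape c.portal .external (c.attachments.flatMap (Attachment.label c.shape))

/-- What the algorithm finds at a child `u` of the current node `v`: an active component, which
is to be packed together with `v`, or the permanent components rooted at `u`, which are not. -/
inductive Item : Type
  | pack : Component → Item
  | gap : List TopTree → Item

/-- The children inside the component `{v} ∪ ⋯` made of the given consecutive items, and its
attachments; `next` is the preorder rank of the next child of `v`, `rank` its child rank. -/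
def assembleFrom : (next rank : ℕ) → List Item → List OrdTree × List Attachment
  | _, _, [] => ([], [])
  | next, rank, .pack c :: is =>
      let r := assembleFrom (next + c.shape.size) (rank + 1) is
      (c.shape :: r.1,
        (c.attachments.map fun a => ⟨next + a.parent, a.rank, a.group⟩) ++ r.2)
  | next, rank, .gap g :: is =>
      let r := assembleFrom next rank is
      (r.1, ⟨0, rank, g⟩ :: r.2)

/-- The component consisting of `v` and of the active components in the given items. -/
def assemble (is : List Item) : Component :=
  let r := assembleFrom 1 0 is
  ⟨.node r.1, r.2⟩

/-- Greedy packing, from left to right, of the items at the children of a node `v`. The current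
component consists of `v` and of the active components in `cur`, `size` is its number of nodes,
and `closed` says that it may not grow any more: this happens when it has reached `B` nodes, and,
unless packing `across` gaps is allowed, at a gap that follows one of its children. A new component
is opened only when there is something to be packed into it. A gap belongs to the current
component. The result is the sequence of items, cut into one block for each component. -/
def greedy (B : ℕ) (across : Bool) :
    (cur : List Item) → (size : ℕ) → (closed : Bool) → List Item → List (List Item)
  | cur, _, _, [] => [cur]
  | cur, size, closed, .pack c :: is =>
      if closed then
        cur :: greedy B across [.pack c] (1 + c.shape.size) (decide (B ≤ 1 + c.shape.size)) is
      else
        greedy B across (cur ++ [.pack c]) (size + c.shape.size)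
          (decide (B ≤ size + c.shape.size)) is
  | cur, size, closed, .gap g :: is =>
      greedy B across (cur ++ [.gap g]) size (closed || (!across && decide (1 < size))) is

/-- The outcome of the algorithm at a node `v`: one component with root `v` that is still
active, or the permanent components with root `v`, from left to right. -/
inductive Outcome : Type
  | active : Component → Outcome
  | permanent : List TopTree → Outcome

/-- The permanent components with root `v` after an active one has been declared permanent. -/
def Outcome.close : Outcome → List TopTree
  | .active c => [c.toMicroTree]
  | .permanent g => g

/-- One step of the algorithm at a node `v`, given, for each of its children from left to right,
whether it is heavy and the outcome of the algorithm there.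
* If at least two children are heavy (`v` is a branching node), then their active components are
  declared permanent, the light children are packed separately in the gaps before, between and
  after the heavy children, and all components are declared permanent.
* Otherwise the active components of all children are packed; if there is a heavy child whose
  components are permanent already, it is left out, and packing continues across it.
  If everything fits into a single component of fewer than `B` nodes, then this component stays
  active; otherwise all components are declared permanent. -/
def coverStep (B : ℕ) (rs : List (Bool × Outcome)) : Outcome :=
  let branching : Bool := decide (2 ≤ rs.countP fun r => r.1)
  let items : List Item := rs.map fun r =>
    if branching && r.1 then .gap r.2.close
    else match r.2 with
      | .active c => .pack c
      | .permanent g => .gap g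
  let components := (greedy B (!branching) [] 1 false items).map assemble
  match branching, components with
  | false, [c] => if c.shape.size < B then .active c else .permanent [c.toMicroTree]
  | _, cs => .permanent (cs.map Component.toMicroTree)

mutual
/-- The bottom-up tree covering algorithm with parameter `B`. -/
def cover (B : ℕ) : OrdTree → Outcome
  | .node cs => coverStep B (coverForest B cs)
/-- For each tree of a sequence, whether it has at least `B` nodes, and its covering. -/
def coverForest (B : ℕ) : List OrdTree → List (Bool × Outcome)
  | [] => []
  | t :: ts => (decide (B ≤ t.size), cover B t) :: coverForest B ts
end

/-- The children of the dummy root of the top tier: the micro trees that contain the root. -/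
def topTier (B : ℕ) (t : OrdTree) : List TopTree :=
  labelGroup .external .external (cover B t).close

mutual
/-- The tree structure of the top tier below a micro tree. -/
def TopTree.skeleton : TopTree → OrdTree
  | .node _ _ _ cs => .node (skeletonForest cs)
/-- The tree structures below the micro trees of a sequence. -/
def skeletonForest : List TopTree → List OrdTree
  | [] => []
  | c :: cs => TopTree.skeleton c :: skeletonForest cs
end

/-- What is stored about one micro tree. -/
structure MicroTree : Type where
  shape : OrdTree
  portal : ℕ × ℕ
  edge : EdgeType

mutual
/-- The micro trees in depth-first order of the top tier. -/
def TopTree.microTrees : TopTree → List MicroTree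
  | .node s q e cs => ⟨s, q, e⟩ :: microTreesForest cs
/-- The micro trees of a sequence of top-tier trees in depth-first order. -/
def microTreesForest : List TopTree → List MicroTree
  | [] => []
  | c :: cs => TopTree.microTrees c ++ microTreesForest cs
end

/-! ## The hypersuccinct code -/

/-- The code for given parameters `B` of the tree covering and `μ` for the width of the portals.
It consists of the numbers of nodes and of micro trees; the shape of the top tier (with dummy
root); the table of codewords (each preceded by its length) and shapes (each preceded by its size),
preceded by its number of entries; the codewords of the micro trees; the portals; the types of the
parent edges. -/
def encodeWith (B μ : ℕ) (t : OrdTree) : List Bool :=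
  let top := topTier B t
  let ms := microTreesForest top
  let shapes := ms.map MicroTree.shape
  let code := lengthRestricted (huffmanCode shapes)
  let table := shapes.dedup
  let width := Nat.clog 2 (μ + 1)
  eliasGamma t.size ++ eliasGamma ms.length ++
    (OrdTree.node (skeletonForest top)).bp ++
    (eliasGamma table.length ++
      table.flatMap fun s =>
        eliasGamma (code s).length ++ code s ++ eliasGamma s.size ++ s.bp) ++
    shapes.flatMap code ++
    (ms.flatMap fun m => fixedWidth width m.portal.1 ++ fixedWidth width m.portal.2) ++
    (ms.flatMap fun m => fixedWidth 3 m.edge.toNat)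

/-- The hypersuccinct code of an ordinal tree with `n` nodes: the parameters are
`B = ⌈(lg n) / 8⌉` and `μ = ⌈(lg n) / 4⌉`. -/
noncomputable def hypersuccinct (t : OrdTree) : List Bool :=
  encodeWith ⌈Real.logb 2 t.size / 8⌉₊ ⌈Real.logb 2 t.size / 4⌉₊ t

end Hypersuccinct

-- Everything rests on comparing the codewords of the micro trees with the source; all else in the
-- code is lower-order.
--
-- Codewords. The Huffman code is at least as short as every assignment of lengths that satisfies
-- the Kraft inequality (`sum_length_huffmanCode_le`), in particular one derived from a source that
-- the encoder does not know. The trees of one size have total probability at most 1, so those with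
-- at most `K = 2B` nodes have total at most `K`, and the lengths `⌈lg (K / P[s])⌉` are admissible.
-- The codewords thus need at most `lg (1 / ∏ P[μᵢ])` bits plus `lg K + 1` bits per micro tree
-- (`sum_length_huffmanCode_le_logb`).
--
-- Probabilities. For a monotonic source `P[t] ≤ ∏ P[μᵢ]` (`treeProb_le_shapesProb`). Tree covering
-- acts on the sequence of child sizes of a node in three ways: sizes shrink to those of active
-- components, skipped children disappear, and the sequence is cut into blocks. The three conditions
-- of monotonicity say precisely that none of these decreases the probability.
--
-- Overhead. Micro trees have at most `2B` nodes (`size_le_of_mem_shapes`), so at most `2 ^ (4B + 1)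
-- = O(√n)` shapes occur and the table needs `O(√n log n)` bits. There are `O(n / B)` micro trees
-- (`mul_card_topShapes_le`), each with `O(log log n)` further bits. The delicate point in that
-- count are micro trees with fewer than `B` nodes; a potential that weighs them against the others
-- and against the size of the tree controls them (`potential_le`).

namespace Hypersuccinct

/-! ## Optimality of Huffman codes -/

/-- The total length of the codewords for symbols given with weights and codeword lengths. -/
def weightedLength (M : Multiset (ℕ × ℕ)) : ℕ := (M.map fun e => e.1 * e.2).sum

/-- The Kraft sum of a multiset of codeword lengths. -/
noncomputable def kraftSum (M : Multiset ℕ) : ℝ := (M.map fun l => ((2 : ℝ) ^ l)⁻¹).sum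

/-- Exchange argument: swapping the length at a lightest symbol with the greatest length keeps the
multisets of weights and of lengths and does not increase the weighted length. Only these multisets
matter for the Kraft sum and for the merging phase, so no symbols are tracked. -/
theorem exists_lightest_longest (M : Multiset (ℕ × ℕ)) (w : ℕ) (hw : w ∈ M.map Prod.fst)
    (hmin : ∀ e ∈ M, w ≤ e.1) :
    ∃ (L : ℕ) (N : Multiset (ℕ × ℕ)), ((w, L) ::ₘ N).map Prod.fst = M.map Prod.fst ∧
      ((w, L) ::ₘ N).map Prod.snd = M.map Prod.snd ∧
      weightedLength ((w, L) ::ₘ N) ≤ weightedLength M ∧ ∀ e ∈ N, e.2 ≤ L := by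
  obtain ⟨⟨w', a⟩, ha, rfl⟩ := Multiset.mem_map.1 hw
  obtain ⟨⟨u, L⟩, hL, hmax⟩ := Finset.exists_max_image M.toFinset Prod.snd ⟨_, by simpa using ha⟩
  simp only [Multiset.mem_toFinset] at hL hmax
  obtain ⟨N, rfl⟩ := Multiset.exists_cons_of_mem ha
  rcases Multiset.mem_cons.1 hL with h | h
  · cases h
    exact ⟨a, N, rfl, rfl, le_rfl, fun e he => hmax e (Multiset.mem_cons_of_mem he)⟩
  · obtain ⟨N, rfl⟩ := Multiset.exists_cons_of_mem h
    refine ⟨L, (u, a) ::ₘ N, by simp, ?_, ?_, ?_⟩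
    · simp [Multiset.cons_swap L a]
    · have h1 : w' ≤ u := hmin _ hL
      have h2 : a ≤ L := hmax _ (Multiset.mem_cons_self _ _)
      simp only [weightedLength, Multiset.map_cons, Multiset.sum_cons]
      nlinarith [mul_le_mul' h1 h2]
    · intro e he
      rcases Multiset.mem_cons.1 he with rfl | he
      · exact hmax (w', a) ha
      · exact hmax _ (by simp [he])

/-- Integrality is what will turn a strict Kraft inequality into room for one more codeword of the
greatest length. -/
theorem exists_kraftSum_eq_div (M : Multiset ℕ) (L : ℕ) (h : ∀ l ∈ M, l ≤ L) :
    ∃ N : ℕ, kraftSum M = N / 2 ^ L := by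
  induction M using Multiset.induction_on with
  | empty => exact ⟨0, by simp [kraftSum]⟩
  | cons a M ih =>
    obtain ⟨N, hN⟩ := ih fun l hl => h l (Multiset.mem_cons_of_mem hl)
    have ha : a ≤ L := h a (Multiset.mem_cons_self _ _)
    refine ⟨2 ^ (L - a) + N, ?_⟩
    have : kraftSum (a ::ₘ M) = ((2 : ℝ) ^ a)⁻¹ + kraftSum M := by simp [kraftSum]
    rw [this, hN]
    push_cast
    rw [add_div, pow_sub₀ _ two_ne_zero ha]
    field_simp

theorem kraftSum_cons (a : ℕ) (M : Multiset ℕ) :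
    kraftSum (a ::ₘ M) = ((2 : ℝ) ^ a)⁻¹ + kraftSum M := by simp [kraftSum]

/-- Merging the two lightest symbols does not destroy optimality. -/
theorem exists_merge_lightest (M : Multiset (ℕ × ℕ)) (v w : ℕ) (W : Multiset ℕ)
    (hM : M.map Prod.fst = v ::ₘ w ::ₘ W) (hvw : v ≤ w) (hW : ∀ u ∈ W, w ≤ u)
    (hk : kraftSum (M.map Prod.snd) ≤ 1) :
    ∃ N : Multiset (ℕ × ℕ), N.map Prod.fst = (v + w) ::ₘ W ∧ kraftSum (N.map Prod.snd) ≤ 1 ∧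
      weightedLength N + (v + w) ≤ weightedLength M := by
  obtain ⟨L, N, h1, h2, h3, h4⟩ := exists_lightest_longest M v (by simp [hM]) (by
    intro e he
    have : e.1 ∈ v ::ₘ w ::ₘ W := hM ▸ Multiset.mem_map_of_mem _ he
    simp only [Multiset.mem_cons] at this
    rcases this with h | h | h
    · exact h.ge
    · exact hvw.trans h.ge
    · exact hvw.trans (hW _ h))
  rw [hM, Multiset.map_cons, Multiset.cons_inj_right] at h1
  obtain ⟨K, N', g1, g2, g3, g4⟩ := exists_lightest_longest N w (by simp [h1]) (by
    intro e he
    have : e.1 ∈ w ::ₘ W := h1 ▸ Multiset.mem_map_of_mem _ he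
    simp only [Multiset.mem_cons] at this
    rcases this with h | h
    · exact h.ge
    · exact hW _ h)
  rw [h1, Multiset.map_cons, Multiset.cons_inj_right] at g1
  have hKL : K ≤ L := by
    have : K ∈ N.map Prod.snd := by rw [← g2]; simp
    obtain ⟨e, he, rfl⟩ := Multiset.mem_map.1 this
    exact h4 e he
  -- The length `L` of the lightest symbol may be lowered to `K`: the other terms sum to `c / 2 ^ K
  -- < 1`, since the term of `L` is positive, and integrality leaves room for another `1 / 2 ^ K`.
  have hk' : kraftSum (K ::ₘ K ::ₘ N'.map Prod.snd) ≤ 1 := by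
    obtain ⟨c, hc⟩ := exists_kraftSum_eq_div (K ::ₘ N'.map Prod.snd) K (by
      intro l hl
      rcases Multiset.mem_cons.1 hl with rfl | hl
      · exact le_rfl
      · obtain ⟨e, he, rfl⟩ := Multiset.mem_map.1 hl
        exact g4 e he)
    rw [← h2, Multiset.map_cons, ← g2, Multiset.map_cons, kraftSum_cons, hc] at hk
    rw [kraftSum_cons, hc]
    have hpos : (0 : ℝ) < 2 ^ K := by positivity
    have hlt : (c : ℝ) / 2 ^ K < 1 := by
      have : (0 : ℝ) < ((2 : ℝ) ^ L)⁻¹ := by positivity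
      simp only at hk
      linarith
    rw [div_lt_one hpos] at hlt
    have hlt' : c + 1 ≤ 2 ^ K := by exact_mod_cast hlt
    have hle : (c : ℝ) + 1 ≤ 2 ^ K := by exact_mod_cast hlt'
    rw [inv_eq_one_div, ← add_div, div_le_one hpos]
    linarith
  have hnn : 0 ≤ kraftSum (N'.map Prod.snd) :=
    Multiset.sum_nonneg fun x hx => by
      obtain ⟨e, -, rfl⟩ := Multiset.mem_map.1 hx
      positivity
  -- Two codewords of length `0` would already have Kraft sum `2`, so `K` is positive.
  obtain ⟨k, rfl⟩ : ∃ k, K = k + 1 := by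
    rcases K with _ | k
    · rw [kraftSum_cons, kraftSum_cons] at hk'
      norm_num at hk'
      linarith
    · exact ⟨k, rfl⟩
  -- The two siblings of length `k + 1` are contracted to their parent at depth `k`; this saves one
  -- bit for each unit of weight.
  refine ⟨(v + w, k) ::ₘ N', by simp [g1], ?_, ?_⟩
  · rw [kraftSum_cons, kraftSum_cons, pow_succ] at hk'
    rw [Multiset.map_cons, kraftSum_cons]
    have : ((2 : ℝ) ^ k * 2)⁻¹ + (2 ^ k * 2)⁻¹ = (2 ^ k)⁻¹ := by field_simp; norm_num
    simp only
    linarith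
  · simp only [weightedLength, Multiset.map_cons, Multiset.sum_cons] at h3 g3 ⊢
    have := Nat.mul_le_mul_left v hKL
    nlinarith

/-- The total length of the codewords of a code tree for symbols with given weights. -/
def CodeTree.cost {α : Type} (f : α → ℕ) (T : CodeTree α) : ℕ :=
  (T.codewords.map fun e => f e.1 * e.2.length).sum

/-- The total weight of the symbols of a code tree. -/
def CodeTree.weight {α : Type} (f : α → ℕ) (T : CodeTree α) : ℕ :=
  (T.codewords.map fun e => f e.1).sum

theorem CodeTree.weight_node {α : Type} (f : α → ℕ) (S T : CodeTree α) :
    (CodeTree.node S T).weight f = S.weight f + T.weight f := by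
  simp [CodeTree.weight, CodeTree.codewords, Function.comp_def]

theorem CodeTree.cost_node {α : Type} (f : α → ℕ) (S T : CodeTree α) :
    (CodeTree.node S T).cost f = S.cost f + T.cost f + (S.weight f + T.weight f) := by
  simp only [CodeTree.cost, CodeTree.weight, CodeTree.codewords, List.map_append, List.map_map,
    Function.comp_def, List.length_cons, mul_add, mul_one, List.sum_append, List.sum_map_add]
  ring

theorem insertByWeight_perm {α : Type} (x : ℕ × CodeTree α) (l : List (ℕ × CodeTree α)) :
    (insertByWeight x l).Perm (x :: l) := by
  induction l with
  | nil => rfl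
  | cons y ys ih =>
    unfold insertByWeight
    split
    · rfl
    · exact (ih.cons y).trans (List.Perm.swap x y ys)

theorem insertByWeight_sorted {α : Type} (x : ℕ × CodeTree α) (l : List (ℕ × CodeTree α))
    (h : l.Pairwise fun a b => a.1 ≤ b.1) :
    (insertByWeight x l).Pairwise fun a b => a.1 ≤ b.1 := by
  induction l with
  | nil => simp [insertByWeight]
  | cons y ys ih =>
    rw [List.pairwise_cons] at h
    unfold insertByWeight
    split
    next hxy =>
      refine List.pairwise_cons.2 ⟨?_, List.pairwise_cons.2 h⟩
      intro z hz
      rcases List.mem_cons.1 hz with rfl | hz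
      · exact hxy
      · exact hxy.trans (h.1 z hz)
    next hxy =>
      refine List.pairwise_cons.2 ⟨?_, ih h.2⟩
      intro z hz
      rcases List.mem_cons.1 ((insertByWeight_perm x ys).mem_iff.1 hz) with rfl | hz
      · exact (not_le.1 hxy).le
      · exact h.1 z hz

/-- The comparison is generalised to a forest, so that it survives a merging step: `M` assigns
depths to the roots of the current code trees, and the final cost is at most the cost inside these
trees plus the weighted depth of their roots. -/
theorem huffmanMerge_spec {α : Type} (f : α → ℕ) (l : List (ℕ × CodeTree α)) (hl : l ≠ [])
    (hs : l.Pairwise fun a b => a.1 ≤ b.1) (hf : ∀ x ∈ l, x.1 = x.2.weight f) :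
    ∃ T, huffmanMerge l = some T ∧
      (T.codewords.map Prod.fst).Perm (l.flatMap fun x => x.2.codewords.map Prod.fst) ∧
      ∀ M : Multiset (ℕ × ℕ), M.map Prod.fst = (l.map Prod.fst : List ℕ) →
        kraftSum (M.map Prod.snd) ≤ 1 →
        T.cost f ≤ (l.map fun x => x.2.cost f).sum + weightedLength M := by
  induction l using huffmanMerge.induct with
  | case1 => exact absurd rfl hl
  | case2 x =>
    refine ⟨x.2, by simp [huffmanMerge], by simp, fun M _ _ => ?_⟩
    simp
  | case3 x y zs ih =>
    have hp := insertByWeight_perm (x.1 + y.1, CodeTree.node x.2 y.2) zs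
    rw [List.pairwise_cons, List.pairwise_cons] at hs
    obtain ⟨T, h1, h2, h3⟩ := ih (fun h => by simp [h] at hp)
      (insertByWeight_sorted _ _ hs.2.2) (by
        intro z hz
        rcases List.mem_cons.1 (hp.mem_iff.1 hz) with rfl | hz
        · rw [CodeTree.weight_node, ← hf x (by simp), ← hf y (by simp)]
        · exact hf z (by simp [hz]))
    refine ⟨T, by rw [huffmanMerge, h1], ?_, ?_⟩
    · refine h2.trans ((hp.flatMap_right _).trans ?_)
      simp [CodeTree.codewords, Function.comp_def]
    · intro M hM hk
      -- Joining `x` and `y` raises the inner cost by `x.1 + y.1`, which is what the contracted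
      -- assignment `N` saves.
      obtain ⟨N, g1, g2, g3⟩ := exists_merge_lightest M x.1 y.1 (zs.map Prod.fst : List ℕ)
        (by simpa using hM) (hs.1 y (by simp)) (by
          intro u hu
          rw [Multiset.mem_coe, List.mem_map] at hu
          obtain ⟨z, hz, rfl⟩ := hu
          exact hs.2.1 z hz) hk
      have := h3 N (by rw [g1]; exact (Multiset.coe_eq_coe.2 (hp.map Prod.fst)).symm) g2
      rw [(hp.map _).sum_eq] at this
      simp only [List.map_cons, List.sum_cons, CodeTree.cost_node] at this ⊢
      rw [← hf x (by simp), ← hf y (by simp)] at this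
      omega

theorem lookup_eq_some_of_mem {α β : Type} [DecidableEq α] (l : List (α × β))
    (h : (l.map Prod.fst).Nodup) (a : α) (b : β) (hab : (a, b) ∈ l) : l.lookup a = some b := by
  induction l with
  | nil => simp at hab
  | cons e l ih =>
    obtain ⟨a', b'⟩ := e
    simp only [List.map_cons, List.nodup_cons] at h
    rcases List.mem_cons.1 hab with h' | h'
    · cases h'
      simp
    · have hne : a ≠ a' := by
        rintro rfl
        exact h.1 (List.mem_map_of_mem (f := Prod.fst) h')
      rw [List.lookup_cons, beq_eq_false_iff_ne.2 hne]
      exact ih h.2 h'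

/-- The Huffman code is at least as short as any code whose lengths satisfy the Kraft
inequality. -/
theorem sum_length_huffmanCode_le {α : Type} [DecidableEq α] (s : List α) (len : α → ℕ)
    (hk : (s.dedup.map fun a => ((2 : ℝ) ^ len a)⁻¹).sum ≤ 1) :
    (s.map fun a => (huffmanCode s a).length).sum ≤ (s.map len).sum := by
  rcases eq_or_ne s [] with rfl | hs
  · simp
  have key : ∀ l : List (ℕ × CodeTree α),
      (l.foldr insertByWeight []).Perm l ∧
        (l.foldr insertByWeight []).Pairwise fun a b => a.1 ≤ b.1 := by
    intro l
    induction l with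
    | nil => simp
    | cons x l ih =>
      exact ⟨(insertByWeight_perm _ _).trans (ih.1.cons x), insertByWeight_sorted _ _ ih.2⟩
  obtain ⟨hp, hsort⟩ := key (s.dedup.map fun a => (s.count a, CodeTree.leaf a))
  obtain ⟨T, h1, h2, h3⟩ := huffmanMerge_spec (fun a => s.count a) _ (fun h => by
    rw [h] at hp
    have := hp.symm.eq_nil
    simp only [List.map_eq_nil_iff] at this
    exact hs ((List.dedup_eq_nil _).1 this)) hsort (by
      intro x hx
      obtain ⟨a, -, rfl⟩ := List.mem_map.1 (hp.mem_iff.1 hx)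
      simp [CodeTree.weight, CodeTree.codewords])
  have hsym : (T.codewords.map Prod.fst).Perm s.dedup := by
    refine h2.trans ((hp.flatMap_right _).trans ?_)
    simp [List.flatMap_map, CodeTree.codewords]
  have hcode : ∀ e ∈ T.codewords, huffmanCode s e.1 = e.2 := by
    intro e he
    simp only [huffmanCode, huffmanTree, h1, Option.elim]
    rw [lookup_eq_some_of_mem _ (hsym.nodup_iff.2 s.nodup_dedup) e.1 e.2 he]
    rfl
  have hcost : T.cost (fun a => s.count a) =
      (s.dedup.map fun a => s.count a * (huffmanCode s a).length).sum := by
    rw [← (hsym.map _).sum_eq, List.map_map, CodeTree.cost]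
    refine congrArg List.sum (List.map_congr_left fun e he => ?_)
    simp [hcode e he]
  have hbound := h3 (s.dedup.map fun a => (s.count a, len a) : List (ℕ × ℕ)) (by
      rw [Multiset.map_coe, Multiset.coe_eq_coe]
      refine List.Perm.trans ?_ (hp.map Prod.fst).symm
      simp [Function.comp_def]) (by
      simpa [kraftSum, Function.comp_def] using hk)
  rw [hcost, (hp.map _).sum_eq] at hbound
  have hdedup : ∀ g : α → ℕ, (s.map g).sum = (s.dedup.map fun a => s.count a * g a).sum := by
    intro g
    rw [Finset.sum_list_map_count, ← List.sum_toFinset _ s.nodup_dedup]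
    exact Finset.sum_congr (by ext; simp) fun _ _ => by simp
  rw [hdedup, hdedup]
  simpa [CodeTree.cost, CodeTree.codewords, weightedLength, Function.comp_def] using hbound

/-! ## Trees, their encodings, and probabilities of trees -/

namespace OrdTree

/-- `OrdTree` is a nested inductive type; this packages the recursor with a second motive over lists
of children. -/
theorem induction {P : OrdTree → Prop} (h : ∀ cs : List OrdTree, (∀ t ∈ cs, P t) → P (node cs))
    (t : OrdTree) : P t :=
  OrdTree.rec (motive_1 := P) (motive_2 := fun cs => ∀ t ∈ cs, P t) h (by simp)
    (fun t ts ht hts s hs => by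
      rcases List.mem_cons.1 hs with rfl | hs
      · exact ht
      · exact hts s hs) t

theorem sizeForest_eq (cs : List OrdTree) : sizeForest cs = (cs.map size).sum := by
  induction cs with
  | nil => rfl
  | cons t ts ih => simp [sizeForest, ih]

theorem size_node (cs : List OrdTree) : (node cs).size = 1 + (cs.map size).sum := by
  rw [size, sizeForest_eq]

theorem size_pos (t : OrdTree) : 0 < t.size := by
  cases t
  rw [size_node]
  omega

theorem size_map_pos (cs : List OrdTree) : ∀ x ∈ cs.map size, 0 < x := by
  intro x hx
  obtain ⟨t, -, rfl⟩ := List.mem_map.1 hx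
  exact t.size_pos

theorem bpForest_eq (cs : List OrdTree) : bpForest cs = cs.flatMap bp := by
  induction cs with
  | nil => rfl
  | cons t ts ih => simp [bpForest, ih]

theorem length_bp (t : OrdTree) : t.bp.length = 2 * t.size := by
  induction t using OrdTree.induction with
  | h cs ih =>
    rw [bp, bpForest_eq, size_node]
    have : (cs.flatMap bp).length = 2 * (cs.map size).sum := by
      induction cs with
      | nil => simp
      | cons t ts ih' =>
        simp only [List.flatMap_cons, List.length_append, List.map_cons, List.sum_cons]
        rw [ih t (by simp), ih' fun s hs => ih s (by simp [hs])]
        ring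
    simp only [List.length_cons, List.length_append, this, List.length_nil]
    ring

/-- Prefix-freeness is the form that induction can prove: every tree code starts with `true`, so the
`false` closing the root marks the end of the sequence of children. -/
theorem bp_append_inj (t : OrdTree) :
    ∀ (s : OrdTree) (x y : List Bool), t.bp ++ x = s.bp ++ y → t = s ∧ x = y := by
  induction t using OrdTree.induction with
  | h cs ih =>
    rintro ⟨ds⟩ x y h
    have key : ∀ ds : List OrdTree, bpForest cs ++ false :: x = bpForest ds ++ false :: y →
        cs = ds ∧ x = y := by
      clear h
      induction cs with
      | nil =>
        rintro (_ | ⟨⟨_⟩, _⟩) h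
        · simpa [bpForest] using h
        · simp [bpForest, bp] at h
      | cons t ts ih' =>
        rintro (_ | ⟨d, ds⟩) h
        · cases t
          simp [bpForest, bp] at h
        · simp only [bpForest, List.append_assoc] at h
          obtain ⟨rfl, h1⟩ := ih t (by simp) _ _ _ h
          obtain ⟨rfl, h2⟩ := ih' (fun s hs => ih s (by simp [hs])) _ h1
          exact ⟨rfl, h2⟩
    obtain ⟨rfl, rfl⟩ := key ds (by simpa [bp] using h)
    exact ⟨rfl, rfl⟩

theorem bp_injective : Function.Injective bp := fun s t h =>
  (bp_append_inj s t [] [] (by simpa using h)).1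

/-- There are at most `2 ^ (2 K + 1)` trees with at most `K` nodes. -/
theorem card_le_of_size_le (S : Finset OrdTree) (K : ℕ) (h : ∀ t ∈ S, t.size ≤ K) :
    S.card ≤ 2 ^ (2 * K + 1) := by
  -- There are fewer than `2 ^ M` binary strings shorter than `M`; trees with at most `K` nodes have
  -- codes shorter than `2 * K + 1`.
  have hcard : ∀ (M : ℕ) (T : Finset (List Bool)), (∀ l ∈ T, l.length < M) → T.card ≤ 2 ^ M := by
    intro M
    induction M with
    | zero =>
      intro T hT
      rw [Finset.card_eq_zero.2 (Finset.eq_empty_of_forall_notMem fun l hl => by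
        simpa using hT l hl)]
      simp
    | succ M ih =>
      intro T hT
      have hsub : T ⊆ (T.filter fun l => l.length < M) ∪
          (Finset.univ : Finset (List.Vector Bool M)).image fun v => v.1 := by
        intro l hl
        by_cases hlM : l.length < M
        · simp [hl, hlM]
        · have := hT l hl
          refine Finset.mem_union_right _ (Finset.mem_image.2 ⟨⟨l, by omega⟩, Finset.mem_univ _, rfl⟩)
      refine (Finset.card_le_card hsub).trans ((Finset.card_union_le _ _).trans ?_)
      have h1 := ih (T.filter fun l => l.length < M) fun l hl => (Finset.mem_filter.1 hl).2
      have h2 := Finset.card_image_le (s := (Finset.univ : Finset (List.Vector Bool M)))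
        (f := fun v => v.1)
      rw [Finset.card_univ, card_vector, Fintype.card_bool] at h2
      rw [pow_succ]
      omega
  rw [← Finset.card_image_of_injective S bp_injective]
  refine hcard _ _ fun l hl => ?_
  obtain ⟨t, ht, rfl⟩ := Finset.mem_image.1 hl
  have := h t ht
  rw [length_bp]
  omega

theorem finite_size_eq (n : ℕ) : {t : OrdTree | t.size = n}.Finite := by
  refine Set.Finite.of_finite_image (f := bp) ?_ bp_injective.injOn
  refine (List.finite_length_eq Bool (2 * n)).subset ?_
  rintro _ ⟨t, rfl, rfl⟩
  exact length_bp t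

end OrdTree

theorem forestProb_eq (p : List ℕ → ℝ) (cs : List OrdTree) :
    forestProb p cs = (cs.map (treeProb p)).prod := by
  induction cs with
  | nil => rfl
  | cons t ts ih => simp [forestProb, ih]

theorem treeProb_nonneg {p : List ℕ → ℝ} (hp : IsFixedSizeSource p) (t : OrdTree) :
    0 ≤ treeProb p t := by
  induction t using OrdTree.induction with
  | h cs ih =>
    rw [treeProb, forestProb_eq]
    refine mul_nonneg (hp.nonneg _ (OrdTree.size_map_pos cs)) (List.prod_nonneg ?_)
    intro x hx
    obtain ⟨t, ht, rfl⟩ := List.mem_map.1 hx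
    exact ih t ht

theorem forestProb_nonneg {p : List ℕ → ℝ} (hp : IsFixedSizeSource p) (cs : List OrdTree) :
    0 ≤ forestProb p cs := by
  rw [forestProb_eq]
  refine List.prod_nonneg fun x hx => ?_
  obtain ⟨t, -, rfl⟩ := List.mem_map.1 hx
  exact treeProb_nonneg hp t

theorem treeProb_pos {p : List ℕ → ℝ} (hp : ∀ l : List ℕ, (∀ x ∈ l, 0 < x) → 0 < p l)
    (t : OrdTree) : 0 < treeProb p t := by
  induction t using OrdTree.induction with
  | h cs ih =>
    rw [treeProb, forestProb_eq]
    refine mul_pos (hp _ (OrdTree.size_map_pos cs)) (List.prod_pos ?_)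
    intro x hx
    obtain ⟨t, ht, rfl⟩ := List.mem_map.1 hx
    exact ih t ht

theorem IsFixedSizeSource.sum_le_one {p : List ℕ → ℝ} (hp : IsFixedSizeSource p) (m : ℕ)
    (S : Finset (List ℕ)) (hS : ∀ l ∈ S, (∀ x ∈ l, 0 < x) ∧ l.sum = m) : ∑ l ∈ S, p l ≤ 1 := by
  rw [← hp.sum_eq_one m]
  have hinj : Function.Injective (Composition.blocks (n := m)) := fun a b h =>
    Composition.ext h
  rw [← Finset.sum_image (f := p) (g := Composition.blocks) (hinj.injOn)]
  refine Finset.sum_le_sum_of_subset_of_nonneg ?_ ?_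
  · intro l hl
    exact Finset.mem_image.2 ⟨⟨l, fun {x} hx => (hS l hl).1 x hx, (hS l hl).2⟩, by simp, rfl⟩
  · intro l hl _
    obtain ⟨c, -, rfl⟩ := Finset.mem_image.1 hl
    exact hp.nonneg _ fun x hx => c.blocks_pos hx

/-- For fixed sizes the subtrees are independent: `F` lies in a product of a set of first trees and
a set of remaining sequences, over which the sum factors. -/
theorem sum_forestProb_le_one {p : List ℕ → ℝ} (hp : IsFixedSizeSource p) (l : List ℕ)
    (h : ∀ k ∈ l, ∀ S : Finset OrdTree, (∀ t ∈ S, t.size = k) → ∑ t ∈ S, treeProb p t ≤ 1)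
    (F : Finset (List OrdTree)) (hF : ∀ f ∈ F, f.map OrdTree.size = l) :
    ∑ f ∈ F, forestProb p f ≤ 1 := by
  induction l generalizing F with
  | nil =>
    have hsub : F ⊆ {[]} := fun f hf => by simpa using hF f hf
    refine (Finset.sum_le_sum_of_subset_of_nonneg hsub fun f _ _ => forestProb_nonneg hp f).trans ?_
    simp [forestProb]
  | cons k l ih =>
    have hcons : ∀ f ∈ F, ∃ t ts, f = t :: ts ∧ t.size = k ∧ ts.map OrdTree.size = l := by
      intro f hf
      have := hF f hf
      rcases f with _ | ⟨t, ts⟩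
      · simp at this
      · simp only [List.map_cons, List.cons.injEq] at this
        exact ⟨t, ts, rfl, this⟩
    set A := F.image fun f => f.headD (.node []) with hA
    set A' := F.image List.tail with hA'
    have hsub : F ⊆ (A ×ˢ A').image fun e => e.1 :: e.2 := by
      intro f hf
      obtain ⟨t, ts, rfl, -⟩ := hcons f hf
      refine Finset.mem_image.2 ⟨(t, ts), Finset.mem_product.2 ⟨?_, ?_⟩, rfl⟩
      · exact Finset.mem_image.2 ⟨_, hf, rfl⟩
      · exact Finset.mem_image.2 ⟨_, hf, rfl⟩
    refine (Finset.sum_le_sum_of_subset_of_nonneg hsub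
      fun f _ _ => forestProb_nonneg hp f).trans ?_
    rw [Finset.sum_image (by rintro ⟨a, b⟩ _ ⟨c, d⟩ _ h; simpa using h), Finset.sum_product]
    simp only [forestProb, ← Finset.mul_sum, ← Finset.sum_mul]
    refine mul_le_one₀ (h k (by simp) A ?_) (Finset.sum_nonneg fun f _ => forestProb_nonneg hp f)
      (ih (fun k hk => h k (by simp [hk])) A' ?_)
    · intro t ht
      obtain ⟨f, hf, rfl⟩ := Finset.mem_image.1 ht
      obtain ⟨t, ts, rfl, h1, h2⟩ := hcons f hf
      exact h1
    · intro t ht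
      obtain ⟨f, hf, rfl⟩ := Finset.mem_image.1 ht
      obtain ⟨t, ts, rfl, h1, h2⟩ := hcons f hf
      exact h2

/-- The probabilities of the trees of a fixed size sum to at most `1`. -/
theorem sum_treeProb_le_one {p : List ℕ → ℝ} (hp : IsFixedSizeSource p) (k : ℕ)
    (S : Finset OrdTree) (hS : ∀ t ∈ S, t.size = k) : ∑ t ∈ S, treeProb p t ≤ 1 := by
  induction k using Nat.strong_induction_on generalizing S with
  | _ k ih =>
    have hinj : Function.Injective OrdTree.node := fun a b h => OrdTree.node.inj h
    set F : Finset (List OrdTree) := S.preimage OrdTree.node hinj.injOn with hFdef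
    have hF : ∀ f ∈ F, 1 + (f.map OrdTree.size).sum = k := by
      intro f hf
      rw [← OrdTree.size_node]
      exact hS _ (Finset.mem_preimage.1 hf)
    have hSF : S = F.image OrdTree.node := by
      ext ⟨cs⟩
      simp [hFdef]
    -- The trees are grouped by the sizes of the subtrees at the root. Each group contributes at
    -- most the probability of its composition of `k - 1`.
    rw [hSF, Finset.sum_image hinj.injOn,
      ← Finset.sum_fiberwise_of_maps_to (g := fun f => f.map OrdTree.size)
        (t := F.image fun f => f.map OrdTree.size) fun f hf => Finset.mem_image_of_mem _ hf]
    refine le_trans (Finset.sum_le_sum fun l hl => ?_) (hp.sum_le_one (k - 1) _ ?_)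
    · obtain ⟨f, hf, rfl⟩ := Finset.mem_image.1 hl
      have : ∀ g ∈ F.filter fun g => g.map OrdTree.size = f.map OrdTree.size,
          treeProb p (.node g) = p (f.map OrdTree.size) * forestProb p g := by
        intro g hg
        rw [treeProb, (Finset.mem_filter.1 hg).2]
      rw [Finset.sum_congr rfl this, ← Finset.mul_sum]
      refine mul_le_of_le_one_right (hp.nonneg _ (OrdTree.size_map_pos f)) ?_
      refine sum_forestProb_le_one hp (f.map OrdTree.size) ?_ _ fun g hg =>
        (Finset.mem_filter.1 hg).2
      intro j hj T hT
      have := List.single_le_sum (fun x _ => Nat.zero_le x) j hj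
      have := hF f hf
      exact ih j (by omega) T hT
    · intro l hl
      obtain ⟨f, hf, rfl⟩ := Finset.mem_image.1 hl
      have := hF f hf
      exact ⟨OrdTree.size_map_pos f, by omega⟩

/-- The probabilities of the trees with at most `K` nodes sum to at most `K`. -/
theorem sum_treeProb_le {p : List ℕ → ℝ} (hp : IsFixedSizeSource p) (K : ℕ)
    (S : Finset OrdTree) (hS : ∀ t ∈ S, t.size ≤ K) : ∑ t ∈ S, treeProb p t ≤ K := by
  rw [← Finset.sum_fiberwise_of_maps_to (g := OrdTree.size) (t := Finset.Icc 1 K)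
    fun t ht => Finset.mem_Icc.2 ⟨t.size_pos, hS t ht⟩]
  refine (Finset.sum_le_sum fun k _ => sum_treeProb_le_one hp k _ fun t ht =>
    (Finset.mem_filter.1 ht).2).trans ?_
  simp

/-! ## Lengths of the integer codes -/

theorem length_eliasGamma_le (n : ℕ) : (eliasGamma n).length ≤ 2 * Nat.log 2 n + 1 := by
  have : n.bits.length ≤ Nat.log 2 n + 1 := by
    rw [Nat.size_eq_bits_len, Nat.size_le]
    exact Nat.lt_pow_succ_log_self one_lt_two n
  simp only [eliasGamma, List.length_append, List.length_replicate, List.length_reverse]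
  omega

theorem length_eliasGamma_le_two_mul (n : ℕ) : (eliasGamma n).length ≤ 2 * n + 1 :=
  (length_eliasGamma_le n).trans (by have := Nat.log_le_self 2 n; omega)

theorem length_fixedWidth (w x : ℕ) : (fixedWidth w x).length = w := by simp [fixedWidth]

/-- The fallback is chosen only if `C t` exceeds `2 |t| + 2 ⌊lg (|t| + 1)⌋`, and it is at most two
bits longer than this threshold, hence at most one bit longer than `C t`. -/
theorem length_lengthRestricted_le_succ (C : OrdTree → List Bool) (t : OrdTree) :
    (lengthRestricted C t).length ≤ (C t).length + 1 := by
  unfold lengthRestricted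
  split
  next h =>
    have := length_eliasGamma_le (t.size + 1)
    simp only [List.length_cons, List.length_append, OrdTree.length_bp]
    omega
  next h => simp

theorem length_lengthRestricted_le (C : OrdTree → List Bool) (t : OrdTree) :
    (lengthRestricted C t).length ≤ 4 * t.size + 2 := by
  have h1 : Nat.log 2 (t.size + 1) ≤ t.size := Nat.lt_succ_iff.1 (Nat.log_lt_self 2 (by omega))
  unfold lengthRestricted
  split
  next h =>
    have := length_eliasGamma_le (t.size + 1)
    simp only [List.length_cons, List.length_append, OrdTree.length_bp]
    omega
  next h =>
    simp only [List.length_cons]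
    omega

/-! ## Shapes of the micro trees -/

/-- The shapes of all micro trees of a sequence of top-tier trees. -/
def topShapes (l : List TopTree) : Multiset OrdTree :=
  ((microTreesForest l).map MicroTree.shape : List OrdTree)

theorem topShapes_cons (c : TopTree) (l : List TopTree) :
    topShapes (c :: l) = topShapes [c] + topShapes l := by
  simp [topShapes, microTreesForest]

theorem topShapes_append (l l' : List TopTree) :
    topShapes (l ++ l') = topShapes l + topShapes l' := by
  induction l with
  | nil => simp [topShapes, microTreesForest]
  | cons c l ih => rw [List.cons_append, topShapes_cons, ih, topShapes_cons c l, add_assoc]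

theorem topShapes_flatMap {ι : Type} (l : List ι) (f : ι → List TopTree) :
    topShapes (l.flatMap f) = (l.map fun i => topShapes (f i)).sum := by
  induction l with
  | nil => simp [topShapes, microTreesForest]
  | cons c l ih => rw [List.flatMap_cons, topShapes_append, ih, List.map_cons, List.sum_cons]

theorem topShapes_map_withEdge (e : EdgeType) (l : List TopTree) :
    topShapes (l.map (TopTree.withEdge e)) = topShapes l := by
  induction l with
  | nil => rfl
  | cons c l ih =>
    rw [List.map_cons, topShapes_cons, ih, topShapes_cons c l]
    rcases c with ⟨s, q, e', cs⟩
    simp [topShapes, microTreesForest, TopTree.withEdge, TopTree.microTrees]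

theorem topShapes_labelGroup (e e' : EdgeType) (l : List TopTree) :
    topShapes (labelGroup e e' l) = topShapes l := by
  cases l with
  | nil => rfl
  | cons c l =>
    rw [labelGroup, topShapes_cons, topShapes_map_withEdge, topShapes_cons c l,
      ← topShapes_map_withEdge e [c]]
    rfl

theorem topShapes_label (s : OrdTree) (a : Attachment) :
    topShapes (a.label s) = topShapes a.group := by
  unfold Attachment.label
  split_ifs <;> exact topShapes_labelGroup _ _ _

/-- The shapes of the micro trees below a component. -/
def Component.attached (c : Component) : Multiset OrdTree :=
  (c.attachments.map fun a => topShapes a.group).sum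

theorem topShapes_toMicroTree (c : Component) :
    topShapes [c.toMicroTree] = c.shape ::ₘ c.attached := by
  have h : ((microTreesForest (c.attachments.flatMap (Attachment.label c.shape))).map
      MicroTree.shape : Multiset OrdTree) = c.attached := by
    rw [← topShapes, topShapes_flatMap]
    simp only [topShapes_label]
    rfl
  simp only [topShapes, Component.toMicroTree, microTreesForest, TopTree.microTrees,
    List.append_nil, List.map_cons, ← h]
  rfl

/-- The shapes of the micro trees below an item. -/
def Item.attached : Item → Multiset OrdTree
  | .pack c => c.attached
  | .gap g => topShapes g

/-- The shapes of the active components among the items. -/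
def packedShapes : List Item → List OrdTree
  | [] => []
  | .pack c :: is => c.shape :: packedShapes is
  | .gap _ :: is => packedShapes is

theorem packedShapes_append (is js : List Item) :
    packedShapes (is ++ js) = packedShapes is ++ packedShapes js := by
  induction is with
  | nil => rfl
  | cons i is ih => cases i <;> simp [packedShapes, ih]

theorem assembleFrom_fst (is : List Item) (next rank : ℕ) :
    (assembleFrom next rank is).1 = packedShapes is := by
  induction is generalizing next rank with
  | nil => rfl
  | cons i is ih => cases i <;> simp [assembleFrom, packedShapes, ih]

theorem assembleFrom_snd (is : List Item) (next rank : ℕ) :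
    ((assembleFrom next rank is).2.map fun a => topShapes a.group).sum =
      (is.map Item.attached).sum := by
  induction is generalizing next rank with
  | nil => rfl
  | cons i is ih =>
    cases i <;> simp [assembleFrom, Item.attached, Component.attached, ih, Function.comp_def]

theorem assemble_shape (is : List Item) : (assemble is).shape = .node (packedShapes is) := by
  simp [assemble, assembleFrom_fst]

theorem assemble_attached (is : List Item) :
    (assemble is).attached = (is.map Item.attached).sum := assembleFrom_snd is 1 0

/-- The number of nodes of the component assembled from a block of items. -/
def blockSize (is : List Item) : ℕ := 1 + ((packedShapes is).map OrdTree.size).sum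

theorem size_assemble (is : List Item) : (assemble is).shape.size = blockSize is := by
  rw [assemble_shape, OrdTree.size_node, blockSize]

theorem blockSize_append_pack (is : List Item) (c : Component) :
    blockSize (is ++ [.pack c]) = blockSize is + c.shape.size := by
  simp [blockSize, packedShapes_append, packedShapes]
  ring

theorem blockSize_append_gap (is : List Item) (g : List TopTree) :
    blockSize (is ++ [.gap g]) = blockSize is := by
  simp [blockSize, packedShapes_append, packedShapes]

theorem blockSize_pack (c : Component) : blockSize [.pack c] = 1 + c.shape.size := by
  simp [blockSize, packedShapes]

theorem blockSize_le_append (is js : List Item) : blockSize is ≤ blockSize (is ++ js) := by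
  simp [blockSize, packedShapes_append]

/-! ## Greedy packing -/

/-- Packing only cuts the sequence of items; none is lost, repeated or moved. -/
theorem flatten_greedy (B : ℕ) (across : Bool) (cur : List Item) (size : ℕ) (closed : Bool)
    (is : List Item) : (greedy B across cur size closed is).flatten = cur ++ is := by
  induction is generalizing cur size closed with
  | nil => simp [greedy]
  | cons i is ih =>
    cases i with
    | pack c =>
      unfold greedy
      split <;> simp [ih]
    | gap g => simp [greedy, ih]

/-- A component that may still grow has at most `B` nodes, and an item adds at most `B`. A newly
opened component has at most `1 + B ≤ 2 * B` nodes. -/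
theorem blockSize_le_of_mem_greedy {B : ℕ} (hB : 1 ≤ B) (across : Bool) (cur : List Item)
    (size : ℕ) (closed : Bool) (is : List Item) (hsize : size = blockSize cur)
    (hcur : size ≤ 2 * B) (hopen : closed = false → size ≤ B)
    (his : ∀ c, Item.pack c ∈ is → c.shape.size ≤ B) :
    ∀ b ∈ greedy B across cur size closed is, blockSize b ≤ 2 * B := by
  induction is generalizing cur size closed with
  | nil =>
    intro b hb
    simp only [greedy, List.mem_singleton] at hb
    subst hb
    omega
  | cons i is ih =>
    have his' : ∀ c, Item.pack c ∈ is → c.shape.size ≤ B := fun c hc => his c (by simp [hc])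
    cases i with
    | pack c =>
      have hc := his c (by simp)
      intro b hb
      unfold greedy at hb
      split at hb
      next h =>
        rcases List.mem_cons.1 hb with rfl | hb
        · omega
        · refine ih _ _ _ (blockSize_pack c).symm (by omega) ?_ his' b hb
          intro h
          have := of_decide_eq_false h
          omega
      next h =>
        have := hopen (by simpa using h)
        refine ih _ _ _ (by rw [blockSize_append_pack, hsize]) (by omega) ?_ his' b hb
        intro h
        have := of_decide_eq_false h
        omega
    | gap g =>
      intro b hb
      unfold greedy at hb
      refine ih _ _ _ (by rw [blockSize_append_gap, hsize]) hcur ?_ his' b hb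
      intro h
      simp only [Bool.or_eq_false_iff] at h
      exact hopen h.1

/-- Whether an item is a gap. -/
def Item.isGap : Item → Bool
  | .pack _ => false
  | .gap _ => true

/-- An undersized block is either the last one or was closed early by a gap, which happens only when
packing across gaps is forbidden. The last summand accounts for a current block that is already
closed while undersized; in the induction it is paid for by the gap. -/
theorem countP_greedy_le (B : ℕ) (across : Bool) (cur : List Item) (size : ℕ) (closed : Bool)
    (is : List Item) (hsize : size = blockSize cur) :
    (greedy B across cur size closed is).countP (fun b => decide (blockSize b < B)) ≤
      1 + (if across then 0 else is.countP Item.isGap) +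
        (if closed = true ∧ size < B then 1 else 0) := by
  induction is generalizing cur size closed with
  | nil =>
    rw [greedy]
    refine List.countP_le_length.trans ?_
    simp
  | cons i is ih =>
    cases i with
    | pack c =>
      have hg : (Item.pack c :: is).countP Item.isGap = is.countP Item.isGap := by
        simp [Item.isGap]
      have hfull : ∀ k, ¬(decide (B ≤ k) = true ∧ k < B) := fun k h => by
        have := of_decide_eq_true h.1
        omega
      rw [hg]
      unfold greedy
      split
      next h =>
        rw [List.countP_cons]
        have := ih [.pack c] (1 + c.shape.size) (decide (B ≤ 1 + c.shape.size))
          (blockSize_pack c).symm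
        rw [if_neg (hfull _)] at this
        simp only [h, true_and, decide_eq_true_eq, ← hsize]
        omega
      next h =>
        have := ih (cur ++ [.pack c]) (size + c.shape.size) (decide (B ≤ size + c.shape.size))
          (by rw [blockSize_append_pack, hsize])
        rw [if_neg (hfull _)] at this
        omega
    | gap g =>
      have hg : (Item.gap g :: is).countP Item.isGap = is.countP Item.isGap + 1 :=
        List.countP_cons_of_pos rfl
      rw [hg]
      unfold greedy
      refine (ih (cur ++ [.gap g]) size (closed || (!across && decide (1 < size)))
        (by rw [blockSize_append_gap, hsize])).trans ?_
      cases across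
      · simp only [Bool.false_eq_true, if_false]
        split_ifs <;> omega
      · simp

theorem greedy_eq_singleton (B : ℕ) (cur : List Item) (is : List Item)
    (h : blockSize (cur ++ is) < B) :
    greedy B true cur (blockSize cur) false is = [cur ++ is] := by
  induction is generalizing cur with
  | nil => simp [greedy]
  | cons i is ih =>
    have h' : blockSize ((cur ++ [i]) ++ is) < B := by simpa using h
    cases i with
    | pack c =>
      have h1 := (blockSize_le_append _ _).trans_lt h'
      rw [blockSize_append_pack] at h1
      have := ih _ h'
      rw [blockSize_append_pack] at this
      simp only [greedy, Bool.false_eq_true, if_false, decide_eq_false (not_le.2 h1)]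
      simpa using this
    | gap g =>
      have := ih _ h'
      rw [blockSize_append_gap] at this
      simpa [greedy] using this

/-! ## Tree covering -/

theorem coverForest_eq (B : ℕ) (cs : List OrdTree) :
    coverForest B cs = cs.map fun t => (decide (B ≤ t.size), cover B t) := by
  induction cs with
  | nil => rfl
  | cons t ts ih => simp [coverForest, ih]

/-- The shapes of the micro trees that have been declared permanent. -/
def Outcome.shapes : Outcome → Multiset OrdTree
  | .active c => c.attached
  | .permanent g => topShapes g

/-- Whether at least two of the trees have at least `B` nodes. -/
def isBranching (B : ℕ) (cs : List OrdTree) : Bool :=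
  decide (2 ≤ cs.countP fun t => decide (B ≤ t.size))

/-- The item for a child of a node, depending on whether that node is branching. -/
def childItem (B : ℕ) (branching : Bool) (t : OrdTree) : Item :=
  if branching && decide (B ≤ t.size) then .gap (cover B t).close
  else match cover B t with
    | .active c => .pack c
    | .permanent g => .gap g

/-- The items for the children of a node. -/
def childItems (B : ℕ) (cs : List OrdTree) : List Item := cs.map (childItem B (isBranching B cs))

/-- The blocks of items for the components at a node. -/
def blocks (B : ℕ) (cs : List OrdTree) : List (List Item) :=
  greedy B (!isBranching B cs) [] 1 false (childItems B cs)

theorem flatten_blocks (B : ℕ) (cs : List OrdTree) : (blocks B cs).flatten = childItems B cs := by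
  rw [blocks, flatten_greedy, List.nil_append]

/-- The outcome at a node, given the items at its children. -/
def packOutcome (B : ℕ) (branching : Bool) (items : List Item) : Outcome :=
  match branching, (greedy B (!branching) [] 1 false items).map assemble with
  | false, [c] => if c.shape.size < B then .active c else .permanent [c.toMicroTree]
  | _, cs => .permanent (cs.map Component.toMicroTree)

theorem cover_node_eq (B : ℕ) (cs : List OrdTree) :
    cover B (.node cs) = packOutcome B (isBranching B cs) (childItems B cs) := by
  have hbr : decide (2 ≤ (coverForest B cs).countP fun r => r.1) = isBranching B cs := by
    rw [coverForest_eq, List.countP_map]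
    rfl
  have hit : ((coverForest B cs).map fun r =>
      if isBranching B cs && r.1 then Item.gap r.2.close
      else match r.2 with
        | .active c => .pack c
        | .permanent g => .gap g) = childItems B cs := by
    rw [coverForest_eq, List.map_map]
    rfl
  have hstep : coverStep B (coverForest B cs) =
      packOutcome B (decide (2 ≤ (coverForest B cs).countP fun r => r.1))
        ((coverForest B cs).map fun r =>
          if decide (2 ≤ (coverForest B cs).countP fun r => r.1) && r.1 then Item.gap r.2.close
          else match r.2 with
            | .active c => .pack c
            | .permanent g => .gap g) := rfl
  rw [cover, hstep, hbr, ← hit]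

/-- Besides the two outcomes this records that, in the permanent case, a single block at a
non-branching node has at least `B` nodes. This excludes a lone undersized block there in
`potential_le`. -/
theorem cover_node (B : ℕ) (cs : List OrdTree) :
    (isBranching B cs = false ∧ cover B (.node cs) = .active (assemble (childItems B cs)) ∧
      blockSize (childItems B cs) < B) ∨
    (cover B (.node cs) =
        .permanent ((blocks B cs).map fun b => (assemble b).toMicroTree) ∧
      (isBranching B cs = false → blocks B cs = [childItems B cs] →
        B ≤ blockSize (childItems B cs))) := by
  have hfl := flatten_blocks B cs
  rw [cover_node_eq, packOutcome.eq_def, ← blocks.eq_def]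
  split
  next br comps c hb hc =>
    obtain ⟨b, hb', rfl⟩ : ∃ b, blocks B cs = [b] ∧ assemble b = c := by
      have := congrArg List.length hc
      simp only [List.length_map, List.length_singleton] at this
      obtain ⟨b, hb'⟩ := List.length_eq_one_iff.1 this
      exact ⟨b, hb', by simpa [hb'] using hc⟩
    rw [hb'] at hfl
    simp only [List.flatten_cons, List.flatten_nil, List.append_nil] at hfl
    subst hfl
    rw [size_assemble]
    split
    next h => exact Or.inl ⟨hb, rfl, h⟩
    next h => exact Or.inr ⟨by rw [hb']; rfl, fun _ _ => not_lt.1 h⟩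
  next br comps hne =>
    refine Or.inr ⟨by rw [List.map_map]; rfl, fun h1 h2 => ?_⟩
    exact absurd (by rw [h2]; rfl) (hne _ h1)

theorem size_lt_of_cover_eq_active {B : ℕ} {t : OrdTree} {c : Component}
    (h : cover B t = .active c) : c.shape.size < B := by
  rcases t with ⟨cs⟩
  rcases cover_node B cs with ⟨-, h1, h2⟩ | ⟨h1, -⟩
  · rw [h1] at h
    cases h
    rwa [size_assemble]
  · rw [h1] at h
    cases h

theorem topShapes_map_toMicroTree (bs : List (List Item)) :
    topShapes (bs.map fun b => (assemble b).toMicroTree) =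
      (bs.map fun b => (assemble b).shape : List OrdTree) + (bs.flatten.map Item.attached).sum := by
  induction bs with
  | nil => rfl
  | cons b bs ih =>
    rw [List.map_cons, topShapes_cons, ih, topShapes_toMicroTree, assemble_attached,
      List.map_cons, List.flatten_cons, List.map_append, List.sum_append, ← Multiset.cons_coe]
    simp only [Multiset.cons_add]
    rw [add_left_comm]

/-- The micro trees at a node whose components are declared permanent. -/
theorem shapes_permanent (B : ℕ) (cs : List OrdTree) :
    topShapes ((blocks B cs).map fun b => (assemble b).toMicroTree) =
      ((blocks B cs).map fun b => (assemble b).shape : List OrdTree) +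
        (cs.map fun t => (childItem B (isBranching B cs) t).attached).sum := by
  rw [topShapes_map_toMicroTree, flatten_blocks, childItems, List.map_map]
  rfl

theorem attached_assemble_childItems (B : ℕ) (cs : List OrdTree) :
    (assemble (childItems B cs)).attached =
      (cs.map fun t => (childItem B (isBranching B cs) t).attached).sum := by
  rw [assemble_attached, childItems, List.map_map]
  rfl

/-- A light tree is covered by a single active component. -/
theorem cover_light (B : ℕ) (t : OrdTree) (h : t.size < B) :
    ∃ c, cover B t = .active c ∧ c.attached = 0 ∧ c.shape.size = t.size := by
  induction t using OrdTree.induction with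
  | h cs ih =>
    rw [OrdTree.size_node] at h
    have hlt : ∀ t ∈ cs, t.size < B := fun t ht =>
      have := List.single_le_sum (fun x _ => Nat.zero_le x) _
        (List.mem_map_of_mem (f := OrdTree.size) ht)
      by omega
    have hbr : isBranching B cs = false := by
      rw [isBranching, List.countP_eq_zero.2 fun t ht => by simpa using hlt t ht]
      rfl
    have hitem : ∀ t ∈ cs, ∃ c, childItem B false t = .pack c ∧ c.attached = 0 ∧
        c.shape.size = t.size := by
      intro t ht
      obtain ⟨c, h1, h2⟩ := ih t ht (hlt t ht)
      exact ⟨c, by simp [childItem, h1], h2⟩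
    have hsum : ∀ ds : List OrdTree, (∀ t ∈ ds, t ∈ cs) →
        ((packedShapes (ds.map (childItem B false))).map OrdTree.size).sum =
          (ds.map OrdTree.size).sum := by
      intro ds hds
      induction ds with
      | nil => rfl
      | cons d ds ihd =>
        obtain ⟨c, h1, -, h3⟩ := hitem d (hds d (by simp))
        simp [h1, packedShapes, h3, ihd fun t ht => hds t (by simp [ht])]
    have hsize : blockSize (childItems B cs) = (OrdTree.node cs).size := by
      rw [blockSize, childItems, hbr, hsum cs fun _ h => h, OrdTree.size_node]
    rcases cover_node B cs with ⟨-, h1, h2⟩ | ⟨h1, h2⟩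
    · refine ⟨_, h1, ?_, by rw [size_assemble, hsize]⟩
      rw [attached_assemble_childItems, hbr]
      refine List.sum_eq_zero fun x hx => ?_
      obtain ⟨t, ht, rfl⟩ := List.mem_map.1 hx
      obtain ⟨c, h1, h2, -⟩ := hitem t ht
      rw [h1]
      exact h2
    · have := h2 hbr (by
        rw [blocks, hbr]
        exact greedy_eq_singleton B [] (childItems B cs) (by
          rw [List.nil_append, hsize, OrdTree.size_node]; exact h))
      rw [hsize, OrdTree.size_node] at this
      omega

theorem topShapes_close (o : Outcome) : topShapes o.close =
    o.shapes + match o with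
      | .active c => {c.shape}
      | .permanent _ => 0 := by
  cases o with
  | active c => simp [Outcome.close, Outcome.shapes, topShapes_toMicroTree, add_comm]
  | permanent g => simp [Outcome.close, Outcome.shapes]

theorem childItem_attached (B : ℕ) (br : Bool) (t : OrdTree) :
    (childItem B br t).attached =
      if br && decide (B ≤ t.size) then topShapes (cover B t).close else (cover B t).shapes := by
  unfold childItem
  split
  · rfl
  · cases cover B t <;> rfl

theorem sum_map_list_sum {ι M : Type} [AddCommMonoid M] (f : OrdTree → M)
    (g : ι → Multiset OrdTree) (l : List ι) :
    (((l.map g).sum).map f).sum = (l.map fun i => ((g i).map f).sum).sum := by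
  induction l with
  | nil => simp
  | cons a l ih => simp [ih]

theorem childItem_eq_pack {B : ℕ} {br : Bool} {t : OrdTree} {c : Component}
    (h : childItem B br t = .pack c) : cover B t = .active c := by
  unfold childItem at h
  split at h
  · cases h
  · split at h
    next h' => cases h; exact h'
    next h' => cases h

/-! ## Sizes of the micro trees -/

theorem size_le_of_mem_close {B : ℕ} {t s : OrdTree}
    (h : ∀ s ∈ (cover B t).shapes, s.size ≤ 2 * B) (hs : s ∈ topShapes (cover B t).close) :
    s.size ≤ 2 * B := by
  rw [topShapes_close, Multiset.mem_add] at hs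
  rcases hs with hs | hs
  · exact h s hs
  · split at hs
    next c hc =>
      rw [Multiset.mem_singleton.1 hs]
      have := size_lt_of_cover_eq_active hc
      omega
    next => simp at hs

theorem mem_list_sum {ι α : Type} {l : List ι} {g : ι → Multiset α} {a : α}
    (h : a ∈ (l.map g).sum) : ∃ i ∈ l, a ∈ g i := by
  induction l with
  | nil => simp at h
  | cons i l ih =>
    rw [List.map_cons, List.sum_cons, Multiset.mem_add] at h
    rcases h with h | h
    · exact ⟨i, by simp, h⟩
    · obtain ⟨j, hj, h⟩ := ih h
      exact ⟨j, by simp [hj], h⟩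

/-- Active components have fewer than `B` nodes, so the bound on greedy blocks applies at every
node; all other micro trees come from the children. -/
theorem size_le_of_mem_shapes {B : ℕ} (hB : 1 ≤ B) (t : OrdTree) :
    ∀ s ∈ (cover B t).shapes, s.size ≤ 2 * B := by
  induction t using OrdTree.induction with
  | h cs ih =>
    have hchild : ∀ s ∈ (cs.map fun t => (childItem B (isBranching B cs) t).attached).sum,
        s.size ≤ 2 * B := by
      intro s hs
      obtain ⟨t, ht, hs⟩ := mem_list_sum hs
      rw [childItem_attached] at hs
      split at hs
      · exact size_le_of_mem_close (ih t ht) hs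
      · exact ih t ht s hs
    rcases cover_node B cs with ⟨-, h, -⟩ | ⟨h, -⟩
    · rw [h, Outcome.shapes, attached_assemble_childItems]
      exact hchild
    · rw [h, Outcome.shapes, shapes_permanent]
      intro s hs
      rcases Multiset.mem_add.1 hs with hs | hs
      · rw [Multiset.mem_coe, List.mem_map] at hs
        obtain ⟨b, hb, rfl⟩ := hs
        rw [size_assemble]
        refine blockSize_le_of_mem_greedy hB _ [] 1 false _ rfl (by omega) (fun _ => hB) ?_ b hb
        intro c hc
        obtain ⟨t, -, ht⟩ := List.mem_map.1 hc
        exact (size_lt_of_cover_eq_active (childItem_eq_pack ht)).le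
      · exact hchild s hs

/-- The number of nodes other than the roots in a multiset of trees. -/
def nonroots (M : Multiset OrdTree) : ℕ := (M.map fun s => s.size - 1).sum

/-- The number of nodes that the active component of an item contributes. -/
def Item.size : Item → ℕ
  | .pack c => c.shape.size
  | .gap _ => 0

theorem sum_size_packedShapes (is : List Item) :
    ((packedShapes is).map OrdTree.size).sum = (is.map Item.size).sum := by
  induction is with
  | nil => rfl
  | cons i is ih => cases i <;> simp [packedShapes, Item.size, ih]

theorem nonroots_assemble (bs : List (List Item)) :
    nonroots ((bs.map fun b => (assemble b).shape : List OrdTree)) =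
      (bs.flatten.map Item.size).sum := by
  induction bs with
  | nil => rfl
  | cons b bs ih =>
    have : (assemble b).shape.size - 1 = (b.map Item.size).sum := by
      rw [size_assemble, blockSize, sum_size_packedShapes]
      omega
    simp only [nonroots, List.map_cons, ← Multiset.cons_coe, Multiset.map_cons,
      Multiset.sum_cons, List.flatten_cons, List.map_append, List.sum_append, this] at ih ⊢
    rw [ih]

theorem nonroots_add (M N : Multiset OrdTree) : nonroots (M + N) = nonroots M + nonroots N := by
  simp [nonroots]

/-- The number of nodes of the component at the root if it is active, and `1` otherwise. -/
def Outcome.rootSize : Outcome → ℕ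
  | .active c => c.shape.size
  | .permanent _ => 1

theorem nonroots_close (o : Outcome) :
    1 + nonroots (topShapes o.close) = o.rootSize + nonroots o.shapes := by
  rw [topShapes_close, nonroots_add]
  cases o with
  | active c =>
    have := c.shape.size_pos
    simp only [nonroots, Outcome.rootSize, Multiset.map_singleton, Multiset.sum_singleton]
    omega
  | permanent g => simp [nonroots, Outcome.rootSize]

/-- Micro trees share only roots, so their non-root nodes are distinct nodes of `t`. The summand
`rootSize` covers the nodes of a component that is still active, or else just the root, which keeps
the induction going whether the parent packs the child or skips it. -/
theorem rootSize_add_nonroots_le (B : ℕ) (t : OrdTree) :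
    (cover B t).rootSize + nonroots (cover B t).shapes ≤ t.size := by
  induction t using OrdTree.induction with
  | h cs ih =>
    have hchild : ∀ t ∈ cs, (childItem B (isBranching B cs) t).size +
        nonroots (childItem B (isBranching B cs) t).attached ≤ t.size := by
      intro t ht
      have h1 := ih t ht
      have h2 := nonroots_close (cover B t)
      unfold childItem
      split
      · simp only [Item.size, Item.attached]
        omega
      · split
        next c hc =>
          rw [hc] at h1
          exact h1
        next g hg =>
          rw [hg] at h1
          simp only [Item.size, Item.attached, Outcome.rootSize, Outcome.shapes] at h1 ⊢
          omega
    have hsum : ((childItems B cs).map Item.size).sum +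
        nonroots (cs.map fun t => (childItem B (isBranching B cs) t).attached).sum ≤
          (cs.map OrdTree.size).sum := by
      rw [nonroots, sum_map_list_sum, childItems, List.map_map, ← List.sum_map_add]
      exact List.sum_le_sum hchild
    rw [OrdTree.size_node]
    rcases cover_node B cs with ⟨-, h, -⟩ | ⟨h, -⟩
    · rw [h, Outcome.shapes, attached_assemble_childItems, Outcome.rootSize, size_assemble,
        blockSize, sum_size_packedShapes]
      omega
    · rw [h, Outcome.shapes, shapes_permanent, Outcome.rootSize, nonroots_add, nonroots_assemble,
        flatten_blocks]
      omega

/-! ## The number of micro trees -/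

/-- Micro trees with fewer than `B` nodes count `B`, all others count `-B`. -/
def potential (B : ℕ) (M : Multiset OrdTree) : ℤ :=
  (M.map fun s => if s.size < B then (B : ℤ) else -B).sum

theorem potential_add (B : ℕ) (M N : Multiset OrdTree) :
    potential B (M + N) = potential B M + potential B N := by
  simp [potential]

theorem potential_close_le (B : ℕ) (t : OrdTree) :
    potential B (topShapes (cover B t).close) ≤ potential B (cover B t).shapes + B := by
  rw [topShapes_close, potential_add]
  split
  next c hc =>
    simp only [potential, Multiset.map_singleton, Multiset.sum_singleton]
    split_ifs <;> omega
  next =>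
    rw [show potential B 0 = 0 from rfl]
    omega

theorem potential_assemble (B : ℕ) (bs : List (List Item)) :
    potential B ((bs.map fun b => (assemble b).shape : List OrdTree)) =
      B * (2 * (bs.countP fun b => decide (blockSize b < B) : ℕ) - bs.length) := by
  induction bs with
  | nil => simp [potential]
  | cons b bs ih =>
    simp only [potential, List.map_cons, ← Multiset.cons_coe, Multiset.map_cons,
      Multiset.sum_cons, List.countP_cons, List.length_cons, size_assemble, decide_eq_true_eq]
      at ih ⊢
    rw [ih]
    push_cast
    split_ifs <;> ring

theorem sum_map_heavy (B : ℕ) (k : ℤ) (cs : List OrdTree) :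
    (cs.map fun t => 5 * (t.size : ℤ) - if B ≤ t.size then k else 0).sum =
      5 * ((cs.map OrdTree.size).sum : ℕ) - k * (cs.countP fun t => decide (B ≤ t.size) : ℕ) := by
  induction cs with
  | nil => simp
  | cons t cs ih =>
    simp only [List.map_cons, List.sum_cons, ih, List.countP_cons, decide_eq_true_eq]
    push_cast
    split_ifs <;> ring

/-- Undersized micro trees become numerous only at branching nodes, and these are rare: each unites
at least two heavy subtrees and so releases credits of `5 * B`. The factor `5` is the least for
which the branching case with two heavy children balances. -/
theorem potential_le (B : ℕ) (t : OrdTree) (h : B ≤ t.size) :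
    potential B (cover B t).shapes + 5 * B ≤ 5 * t.size := by
  induction t using OrdTree.induction with
  | h cs ih =>
    have hlight : ∀ t, t.size < B → potential B (cover B t).shapes = 0 := by
      intro t ht
      obtain ⟨c, h1, h2, -⟩ := cover_light B t ht
      rw [h1, Outcome.shapes, h2]
      rfl
    set H := cs.countP fun t => decide (B ≤ t.size) with hH
    set X := (cs.map fun t => (childItem B (isBranching B cs) t).attached).sum with hX
    have hXsum : potential B X =
        (cs.map fun t => potential B (childItem B (isBranching B cs) t).attached).sum := by
      rw [hX, potential, sum_map_list_sum]
      rfl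
    have hsz := OrdTree.size_node cs
    rcases hbr : isBranching B cs with _ | _
    · have hH2 : H < 2 := by
        simpa [isBranching] using hbr
      have hXle : potential B X + 5 * B ≤ 5 * (OrdTree.node cs).size := by
        have hle : ∀ t ∈ cs, potential B (childItem B (isBranching B cs) t).attached ≤
            5 * (t.size : ℤ) - if B ≤ t.size then 5 * (B : ℤ) else 0 := by
          intro t ht
          rw [childItem_attached, hbr, Bool.false_and, if_neg (by simp)]
          split_ifs with hB
          · have := ih t ht hB
            omega
          · rw [hlight t (not_le.1 hB)]
            omega
        rcases Nat.eq_zero_or_pos H with h0 | h1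
        · rw [hXsum, List.sum_eq_zero]
          · omega
          · intro x hx
            obtain ⟨t, ht, rfl⟩ := List.mem_map.1 hx
            have : ¬B ≤ t.size := by
              have := List.countP_eq_zero.1 (hH.symm.trans h0) t ht
              simpa using this
            rw [childItem_attached, hbr, Bool.false_and, if_neg (by simp),
              hlight t (not_le.1 this)]
        · have hH1 : H = 1 := by omega
          have := List.sum_le_sum hle
          rw [sum_map_heavy, ← hXsum, ← hH, hH1] at this
          rw [hsz]
          push_cast at this ⊢
          omega
      rcases cover_node B cs with ⟨-, h1, h2⟩ | ⟨h1, h2⟩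
      · rw [h1, Outcome.shapes, attached_assemble_childItems]
        exact hXle
      · rw [h1, Outcome.shapes, shapes_permanent, ← hX, potential_add, potential_assemble]
        have hu : (blocks B cs).countP (fun b => decide (blockSize b < B)) ≤ 1 := by
          have := countP_greedy_le B (!isBranching B cs) [] 1 false (childItems B cs) rfl
          rw [hbr] at this
          rw [blocks, hbr]
          simpa using this
        -- Only one block can be undersized, and it is not the only block; so at most half of the
        -- blocks are undersized and the new micro trees do not raise the potential.
        have hN : 2 * (blocks B cs).countP (fun b => decide (blockSize b < B)) ≤
            (blocks B cs).length := by
          have hfl := flatten_blocks B cs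
          rcases hb : blocks B cs with _ | ⟨b, _ | ⟨b', bs⟩⟩
          · simp
          · rw [hb] at hfl
            simp only [List.flatten_cons, List.flatten_nil, List.append_nil] at hfl
            subst hfl
            have := h2 hbr hb
            simp [this]
          · rw [hb] at hu
            simp only [List.length_cons]
            omega
        have : (B : ℤ) * (2 * ((blocks B cs).countP (fun b => decide (blockSize b < B)) : ℕ) -
            (blocks B cs).length) ≤ 0 :=
          mul_nonpos_of_nonneg_of_nonpos (by positivity) (by omega)
        omega
    · have hH2 : 2 ≤ H := by
        simpa [isBranching] using hbr
      -- Closing the active component of a heavy child costs at most `B`, which leaves `4 * B` of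
      -- its credit.
      have hle : ∀ t ∈ cs, potential B (childItem B (isBranching B cs) t).attached ≤
          5 * (t.size : ℤ) - if B ≤ t.size then 4 * (B : ℤ) else 0 := by
        intro t ht
        rw [childItem_attached, hbr, Bool.true_and]
        split_ifs with h1 h2 h2
        · have := ih t ht h2
          have := potential_close_le B t
          omega
        · simp [h2] at h1
        · simp [h2] at h1
        · rw [hlight t (not_le.1 h2)]
          omega
      have hXle := List.sum_le_sum hle
      rw [sum_map_heavy, ← hXsum, ← hH] at hXle
      rcases cover_node B cs with ⟨h1, -⟩ | ⟨h1, -⟩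
      · simp [h1] at hbr
      · rw [h1, Outcome.shapes, shapes_permanent, ← hX, potential_add, potential_assemble]
        have hgap : (childItems B cs).countP Item.isGap ≤ H := by
          rw [childItems, List.countP_map, hH]
          refine List.countP_mono_left fun t ht hg => ?_
          by_contra hlt
          obtain ⟨c, h1, -⟩ := cover_light B t (by simpa using hlt)
          simp only [decide_eq_true_eq] at hlt
          simp [childItem, h1, hlt, Item.isGap] at hg
        have hu := countP_greedy_le B (!isBranching B cs) [] 1 false (childItems B cs) rfl
        rw [← blocks] at hu
        simp only [hbr, Bool.not_true, Bool.false_eq_true, if_false, false_and, add_zero] at hu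
        have hN : (blocks B cs).countP (fun b => decide (blockSize b < B)) ≤
          (blocks B cs).length := List.countP_le_length
        rw [hsz]
        push_cast
        -- At most `1 + H` new blocks are undersized. In total `-4 * B * H + B * (1 + H) = B - 3 * B
        -- * H ≤ -5 * B`, because `H ≥ 2`.
        have h3 : (B : ℤ) * (2 * ((blocks B cs).countP (fun b => decide (blockSize b < B)) : ℕ) -
            (blocks B cs).length) ≤ B * (1 + H) :=
          mul_le_mul_of_nonneg_left (by omega) (by positivity)
        have h4 : (B : ℤ) * 2 ≤ B * H :=
          mul_le_mul_of_nonneg_left (by exact_mod_cast hH2) (by positivity)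
        push_cast at hXle
        nlinarith

/-- A tree with at least `B` nodes counts `-B` in the potential, so `2 * B` restores its share `B`
of the left side. -/
theorem card_mul_le_potential (B : ℕ) (M : Multiset OrdTree) :
    (B : ℤ) * M.card ≤ potential B M + 2 * B * (M.countP fun s => B ≤ s.size : ℕ) := by
  induction M using Multiset.induction_on with
  | empty => simp [potential]
  | cons s M ih =>
    simp only [potential, Multiset.map_cons, Multiset.sum_cons, Multiset.card_cons,
      Multiset.countP_cons] at ih ⊢
    push_cast
    split_ifs with h1 h2 h2
    · omega
    · linarith
    · linarith
    · omega

theorem countP_mul_le_nonroots (B : ℕ) (M : Multiset OrdTree) :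
    (B - 1) * (M.countP fun s => B ≤ s.size) ≤ nonroots M := by
  induction M using Multiset.induction_on with
  | empty => simp [nonroots]
  | cons s M ih =>
    simp only [nonroots, Multiset.map_cons, Multiset.sum_cons, Multiset.countP_cons] at ih ⊢
    split_ifs with h
    · rw [mul_add, mul_one]
      omega
    · rw [add_zero]
      omega

/-- The Farzan–Munro algorithm produces `O(n / B)` micro trees. -/
theorem mul_card_topShapes_le {B : ℕ} (hB : 2 ≤ B) (t : OrdTree) (h : B ≤ t.size) :
    B * (topShapes (cover B t).close).card ≤ 9 * t.size := by
  set M := topShapes (cover B t).close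
  have h1 := potential_le B t h
  have h2 : potential B M ≤ _ := potential_close_le B t
  have h3 := rootSize_add_nonroots_le B t
  rw [← nonroots_close] at h3
  have h4 := countP_mul_le_nonroots B M
  have h5 := card_mul_le_potential B M
  set F := M.countP fun s => B ≤ s.size
  -- `B ≤ 2 * (B - 1)` since `B ≥ 2`. So `2 * B * F ≤ 4 * |t|`, which together with the potential
  -- bound `5 * |t|` gives the constant `9`.
  have h6 : B * F ≤ 2 * ((B - 1) * F) := by
    rw [← mul_assoc]
    exact Nat.mul_le_mul_right F (by omega)
  have h7 : B * F ≤ 2 * t.size := by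
    change 1 + nonroots M ≤ _ at h3
    omega
  zify at h7 ⊢
  linarith

/-! ## Probabilities of the micro trees -/

/-- The product of the probabilities of the trees of a multiset. -/
noncomputable def shapesProb (p : List ℕ → ℝ) (M : Multiset OrdTree) : ℝ :=
  (M.map (treeProb p)).prod

theorem shapesProb_add (p : List ℕ → ℝ) (M N : Multiset OrdTree) :
    shapesProb p (M + N) = shapesProb p M * shapesProb p N := by
  simp [shapesProb]

theorem shapesProb_nonneg {p : List ℕ → ℝ} (hp : IsFixedSizeSource p) (M : Multiset OrdTree) :
    0 ≤ shapesProb p M :=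
  Multiset.prod_nonneg fun x hx => by
    obtain ⟨t, -, rfl⟩ := Multiset.mem_map.1 hx
    exact treeProb_nonneg hp t

theorem IsMonotonic.component_le {p : List ℕ → ℝ} (hp : IsMonotonic p) (a b : List ℕ) (m n : ℕ)
    (ha : ∀ x ∈ a, 0 < x) (hb : ∀ x ∈ b, 0 < x) (hm : 0 < m) (hmn : m ≤ n) :
    p (a ++ n :: b) ≤ p (a ++ m :: b) := by
  induction n, hmn using Nat.le_induction with
  | base => exact le_rfl
  | succ n hn ih => exact (hp.component a b n ha hb (hm.trans_le hn)).trans ih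

/-- Deleting and shrinking subtrees does not decrease the probability. -/
theorem IsMonotonic.le_packed {p : List ℕ → ℝ} (hp : IsMonotonic p) (cs : List OrdTree)
    (f : OrdTree → Item) (hf : ∀ t ∈ cs, (f t).size ≤ t.size) (a : List ℕ)
    (ha : ∀ x ∈ a, 0 < x) :
    p (a ++ cs.map OrdTree.size) ≤ p (a ++ (packedShapes (cs.map f)).map OrdTree.size) := by
  induction cs generalizing a with
  | nil => exact le_rfl
  | cons t cs ih =>
    have ih' := ih fun s hs => hf s (by simp [hs])
    have ht := hf t (by simp)
    have hcs := OrdTree.size_map_pos cs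
    rw [List.map_cons, List.map_cons]
    cases hft : f t with
    | pack c =>
      rw [hft] at ht
      refine (hp.component_le a _ _ _ ha hcs c.shape.size_pos ht).trans ?_
      have := ih' (a ++ [c.shape.size]) (by
        intro x hx
        rcases List.mem_append.1 hx with hx | hx
        · exact ha x hx
        · rw [List.mem_singleton.1 hx]
          exact c.shape.size_pos)
      simpa [packedShapes] using this
    | gap g =>
      -- A skipped child is first shrunk to size one and then deleted.
      refine (hp.component_le a _ 1 _ ha hcs one_pos t.size_pos).trans ?_
      exact (hp.insert_one a _ ha hcs).trans (ih' a ha)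

/-- Splitting the children of a node does not decrease the probability. -/
theorem IsMonotonic.le_prod_split {p : List ℕ → ℝ} (hs : IsFixedSizeSource p) (hp : IsMonotonic p)
    (bs : List (List Item)) :
    p ((packedShapes bs.flatten).map OrdTree.size) ≤
      (bs.map fun b => p ((packedShapes b).map OrdTree.size)).prod := by
  induction bs with
  | nil => exact hs.le_one [] (by simp)
  | cons b bs ih =>
    rw [List.flatten_cons, packedShapes_append, List.map_append, List.map_cons, List.prod_cons]
    refine (hp.submul _ _ (OrdTree.size_map_pos _) (OrdTree.size_map_pos _)).trans ?_
    exact mul_le_mul_of_nonneg_left ih (hs.nonneg _ (OrdTree.size_map_pos _))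

/-- The shared root contributes one factor per block, while the nodes below it contribute as if the
blocks had not been separated. -/
theorem shapesProb_assemble (p : List ℕ → ℝ) (bs : List (List Item)) :
    shapesProb p ((bs.map fun b => (assemble b).shape : List OrdTree)) =
      (bs.map fun b => p ((packedShapes b).map OrdTree.size)).prod *
        forestProb p (packedShapes bs.flatten) := by
  induction bs with
  | nil => simp [shapesProb, packedShapes, forestProb]
  | cons b bs ih =>
    rw [List.map_cons, ← Multiset.cons_coe, ← Multiset.singleton_add, shapesProb_add, ih,
      List.flatten_cons, packedShapes_append, forestProb_eq p (_ ++ _), List.map_append,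
      List.prod_append, ← forestProb_eq, ← forestProb_eq]
    simp only [shapesProb, Multiset.map_singleton, Multiset.prod_singleton, assemble_shape,
      treeProb, List.map_cons, List.prod_cons]
    ring

/-- The probability of the active component at the root (`1` if there is none). -/
noncomputable def Outcome.rootProb (p : List ℕ → ℝ) : Outcome → ℝ
  | .active c => treeProb p c.shape
  | .permanent _ => 1

theorem shapesProb_close (p : List ℕ → ℝ) (o : Outcome) :
    shapesProb p (topShapes o.close) = o.rootProb p * shapesProb p o.shapes := by
  rw [topShapes_close, shapesProb_add, mul_comm]
  cases o <;> simp [shapesProb, Outcome.rootProb]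

/-- An active component is kept apart as `rootProb` because its fate is decided only at the parent.
The root factor is handled by shrinking, deleting and splitting the child sizes, the remaining
factors by induction. -/
theorem treeProb_le_cover {p : List ℕ → ℝ} (hs : IsFixedSizeSource p) (hp : IsMonotonic p)
    (B : ℕ) (t : OrdTree) :
    treeProb p t ≤ (cover B t).rootProb p * shapesProb p (cover B t).shapes := by
  induction t using OrdTree.induction with
  | h cs ih =>
    set f := childItem B (isBranching B cs) with hf
    have hsize : ∀ t ∈ cs, (f t).size ≤ t.size := by
      intro t ht
      cases hft : f t with
      | pack c =>
        have := rootSize_add_nonroots_le B t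
        rw [childItem_eq_pack hft, Outcome.rootSize] at this
        exact (Nat.le_add_right _ _).trans this
      | gap g => exact Nat.zero_le _
    have hchild : ∀ ds : List OrdTree, (∀ t ∈ ds, t ∈ cs) → forestProb p ds ≤
        forestProb p (packedShapes (ds.map f)) *
          shapesProb p (ds.map fun t => (f t).attached).sum := by
      intro ds hds
      induction ds with
      | nil => simp [forestProb, packedShapes, shapesProb]
      | cons t ds ihd =>
        have h1 := ihd fun s hs => hds s (by simp [hs])
        have h2 := ih t (hds t (by simp))
        rw [forestProb, List.map_cons, List.map_cons, List.sum_cons, shapesProb_add]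
        have h3 : treeProb p t * forestProb p ds ≤ _ :=
          mul_le_mul h2 h1 (forestProb_nonneg hs ds)
            ((treeProb_nonneg hs t).trans h2)
        refine h3.trans (le_of_eq ?_)
        have hft : f t = childItem B (isBranching B cs) t := rfl
        rw [childItem] at hft
        split at hft
        · rw [hft, packedShapes, Item.attached, shapesProb_close]
          ring
        · split at hft
          next c hc =>
            rw [hft, hc, packedShapes, Item.attached, forestProb, Outcome.rootProb,
              Outcome.shapes]
            ring
          next g hg =>
            rw [hft, hg, packedShapes, Item.attached, Outcome.rootProb, Outcome.shapes]
            ring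
    have hfor := hchild cs fun _ h => h
    have hroot := hp.le_packed cs f hsize [] (by simp)
    simp only [List.nil_append] at hroot
    have hX : cs.map f = childItems B cs := rfl
    rw [hX] at hfor hroot
    rw [treeProb]
    have hnn := shapesProb_nonneg hs (cs.map fun t => (f t).attached).sum
    rcases cover_node B cs with ⟨-, h, -⟩ | ⟨h, -⟩
    · rw [h, Outcome.shapes, attached_assemble_childItems, Outcome.rootProb, assemble_shape,
        treeProb, mul_assoc]
      exact mul_le_mul hroot hfor (forestProb_nonneg hs cs)
        (hs.nonneg _ (OrdTree.size_map_pos _))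
    · rw [h, Outcome.shapes, shapes_permanent, Outcome.rootProb, shapesProb_add,
        shapesProb_assemble, one_mul, flatten_blocks, mul_assoc]
      have hsplit := IsMonotonic.le_prod_split hs hp (blocks B cs)
      rw [flatten_blocks] at hsplit
      have := hroot.trans hsplit
      exact mul_le_mul this hfor (forestProb_nonneg hs cs)
        ((hs.nonneg _ (OrdTree.size_map_pos _)).trans this)

/-- The probability of a tree is at most the product of the probabilities of its micro trees. -/
theorem treeProb_le_shapesProb {p : List ℕ → ℝ} (hs : IsFixedSizeSource p) (hp : IsMonotonic p)
    (B : ℕ) (t : OrdTree) : treeProb p t ≤ shapesProb p (topShapes (cover B t).close) := by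
  rw [shapesProb_close]
  exact treeProb_le_cover hs hp B t

/-! ## Uniform composition trees -/

theorem uniformComposition_pos (l : List ℕ) : 0 < uniformComposition l := by
  unfold uniformComposition
  positivity

theorem uniformComposition_le_of_sum_le {l l' : List ℕ} (h : l.sum ≤ l'.sum) :
    uniformComposition l' ≤ uniformComposition l := by
  unfold uniformComposition
  exact one_div_le_one_div_of_le (by positivity)
    (pow_le_pow_right₀ one_le_two (Nat.sub_le_sub_right h 1))

theorem isFixedSizeSource_uniformComposition : IsFixedSizeSource uniformComposition where
  nonneg l _ := (uniformComposition_pos l).le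
  le_one l _ := by
    have := uniformComposition_le_of_sum_le (l := []) (l' := l) (by simp)
    simpa [uniformComposition] using this
  sum_eq_one m := by
    simp [uniformComposition, Composition.blocks_sum, composition_card]

theorem isMonotonic_uniformComposition : IsMonotonic uniformComposition where
  component a b m _ _ _ := uniformComposition_le_of_sum_le (by simp)
  insert_one a b _ _ := uniformComposition_le_of_sum_le (by simp)
  submul a b _ _ := by
    unfold uniformComposition
    rw [one_div_mul_one_div, ← pow_add]
    -- Truncated subtraction covers empty sequences: `(x - 1) + (y - 1) ≤ x + y - 1` holds for all
    -- natural numbers.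
    refine one_div_le_one_div_of_le (by positivity) (pow_le_pow_right₀ one_le_two ?_)
    rw [List.sum_append]
    omega

/-! ## Random LRM-trees -/

/-- The product of the reciprocals of `s` plus the partial sums of a list. -/
noncomputable def lrmFrom : ℕ → List ℕ → ℝ
  | _, [] => 1
  | s, n :: l => 1 / ((s + n : ℕ) : ℝ) * lrmFrom (s + n) l

theorem lrmFrom_eq_prod (s : ℕ) (l : List ℕ) :
    lrmFrom s l = ∏ j ∈ Finset.range l.length, 1 / ((s + (l.take (j + 1)).sum : ℕ) : ℝ) := by
  induction l generalizing s with
  | nil => simp [lrmFrom]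
  | cons n l ih =>
    rw [lrmFrom, ih, List.length_cons, Finset.prod_range_succ', mul_comm]
    simp [add_assoc]

theorem lrmSource_eq (l : List ℕ) : lrmSource l = lrmFrom 0 l := by
  rw [lrmFrom_eq_prod, lrmSource]
  simp

theorem lrmFrom_append (s : ℕ) (a b : List ℕ) :
    lrmFrom s (a ++ b) = lrmFrom s a * lrmFrom (s + a.sum) b := by
  induction a generalizing s with
  | nil => simp [lrmFrom]
  | cons n a ih => simp [lrmFrom, ih, mul_assoc, add_assoc]

theorem lrmFrom_pos (s : ℕ) (l : List ℕ) (hl : ∀ x ∈ l, 0 < x) : 0 < lrmFrom s l := by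
  induction l generalizing s with
  | nil => simp [lrmFrom]
  | cons n l ih =>
    have hn := hl n (by simp)
    have h : (0 : ℝ) < ((s + n : ℕ) : ℝ) := by exact_mod_cast (by omega : 0 < s + n)
    exact mul_pos (one_div_pos.2 h) (ih _ fun x hx => hl x (by simp [hx]))

/-- A larger offset enlarges every partial sum. All three monotonicity conditions come down to such
a shift of the parts on the right. -/
theorem lrmFrom_anti {s s' : ℕ} (h : s ≤ s') (l : List ℕ) (hl : ∀ x ∈ l, 0 < x) :
    lrmFrom s' l ≤ lrmFrom s l := by
  induction l generalizing s s' with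
  | nil => simp [lrmFrom]
  | cons n l ih =>
    have hn := hl n (by simp)
    have hl' : ∀ x ∈ l, 0 < x := fun x hx => hl x (by simp [hx])
    have h0 : (0 : ℝ) < ((s + n : ℕ) : ℝ) := by exact_mod_cast (by omega : 0 < s + n)
    exact mul_le_mul (one_div_le_one_div_of_le h0 (by exact_mod_cast (by omega)))
      (ih (by omega) hl') (lrmFrom_pos _ _ hl').le (one_div_nonneg.2 h0.le)

theorem one_div_natCast_le_one (n : ℕ) : 1 / (n : ℝ) ≤ 1 := by
  rcases Nat.eq_zero_or_pos n with rfl | h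
  · simp
  · exact div_le_one_of_le₀ (by exact_mod_cast h) (by positivity)

theorem lrmFrom_le_one (s : ℕ) (l : List ℕ) (hl : ∀ x ∈ l, 0 < x) : lrmFrom s l ≤ 1 := by
  induction l generalizing s with
  | nil => simp [lrmFrom]
  | cons n l ih =>
    have hl' : ∀ x ∈ l, 0 < x := fun x hx => hl x (by simp [hx])
    exact mul_le_one₀ (one_div_natCast_le_one _) (lrmFrom_pos _ _ hl').le (ih _ hl')

/-- The compositions of `m` as a finite set of lists. -/
def compositionLists (m : ℕ) : Finset (List ℕ) :=
  Finset.univ.image fun c : Composition m => c.blocks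

theorem mem_compositionLists {m : ℕ} {l : List ℕ} :
    l ∈ compositionLists m ↔ (∀ x ∈ l, 0 < x) ∧ l.sum = m := by
  simp only [compositionLists, Finset.mem_image, Finset.mem_univ, true_and]
  constructor
  · rintro ⟨c, rfl⟩
    exact ⟨fun x hx => c.blocks_pos hx, c.blocks_sum⟩
  · rintro ⟨h1, h2⟩
    exact ⟨⟨l, fun {x} hx => h1 x hx, h2⟩, rfl⟩

theorem sum_composition (m : ℕ) (f : List ℕ → ℝ) :
    ∑ c : Composition m, f c.blocks = ∑ l ∈ compositionLists m, f l := by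
  rw [compositionLists, Finset.sum_image]
  intro a _ b _ h
  exact Composition.ext h

/-- The last factor is always `1 / (m + 1)`. Grouping by the sum `i ≤ m` of all parts but the last,
each of the `m + 1` groups contributes `1 / (m + 1)` by induction. -/
theorem sum_lrmFrom (m : ℕ) : ∑ l ∈ compositionLists m, lrmFrom 0 l = 1 := by
  induction m using Nat.strong_induction_on with
  | _ m ih =>
    rcases m with _ | m
    · have : compositionLists 0 = {[]} := by
        ext l
        rw [mem_compositionLists, Finset.mem_singleton]
        constructor
        · rintro ⟨h1, h2⟩
          refine List.eq_nil_iff_forall_not_mem.2 fun x hx => ?_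
          have := List.single_le_sum (fun x _ => Nat.zero_le x) x hx
          have := h1 x hx
          omega
        · rintro rfl
          simp
      simp [this, lrmFrom]
    · have hlast : ∀ l ∈ compositionLists (m + 1), ∃ a n, l = a ++ [n] ∧ (∀ x ∈ a, 0 < x) ∧
          0 < n ∧ a.sum + n = m + 1 := by
        intro l hl
        obtain ⟨h1, h2⟩ := mem_compositionLists.1 hl
        rcases List.eq_nil_or_concat l with rfl | ⟨a, n, rfl⟩
        · simp at h2
        · rw [List.concat_eq_append] at *
          exact ⟨a, n, rfl, fun x hx => h1 x (by simp [hx]), h1 n (by simp), by simpa using h2⟩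
      rw [← Finset.sum_fiberwise_of_maps_to (g := fun l => l.dropLast.sum)
        (t := Finset.range (m + 1))]
      · have hfib : ∀ i ∈ Finset.range (m + 1),
            ∑ l ∈ compositionLists (m + 1) with l.dropLast.sum = i, lrmFrom 0 l =
              1 / ((m + 1 : ℕ) : ℝ) := by
          intro i hi
          rw [Finset.mem_range] at hi
          have hone : 1 / ((m + 1 : ℕ) : ℝ) =
              1 / ((m + 1 : ℕ) : ℝ) * ∑ l ∈ compositionLists i, lrmFrom 0 l := by
            rw [ih i hi, mul_one]
          rw [hone, Finset.mul_sum]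
          refine Finset.sum_nbij' List.dropLast (fun a => a ++ [m + 1 - i]) ?_ ?_ ?_ ?_ ?_
          · intro l hl
            obtain ⟨hl, hli⟩ := Finset.mem_filter.1 hl
            obtain ⟨a, n, rfl, h1, h2, h3⟩ := hlast l hl
            rw [List.dropLast_concat] at *
            exact mem_compositionLists.2 ⟨h1, hli⟩
          · intro a ha
            obtain ⟨h1, h2⟩ := mem_compositionLists.1 ha
            refine Finset.mem_filter.2 ⟨mem_compositionLists.2 ⟨?_, ?_⟩, ?_⟩
            · intro x hx
              rcases List.mem_append.1 hx with hx | hx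
              · exact h1 x hx
              · rw [List.mem_singleton.1 hx]
                omega
            · simp [h2]
              omega
            · rw [List.dropLast_concat, h2]
          · intro l hl
            obtain ⟨hl, hli⟩ := Finset.mem_filter.1 hl
            obtain ⟨a, n, rfl, h1, h2, h3⟩ := hlast l hl
            rw [List.dropLast_concat] at *
            congr 2
            omega
          · intro a _
            rw [List.dropLast_concat]
          · intro l hl
            obtain ⟨hl, hli⟩ := Finset.mem_filter.1 hl
            obtain ⟨a, n, rfl, h1, h2, h3⟩ := hlast l hl
            rw [List.dropLast_concat, lrmFrom_append, lrmFrom, lrmFrom, zero_add, h3]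
            ring
        rw [Finset.sum_congr rfl hfib, Finset.sum_const, Finset.card_range, nsmul_eq_mul]
        exact mul_one_div_cancel (by positivity)
      · intro l hl
        obtain ⟨a, n, rfl, h1, h2, h3⟩ := hlast l hl
        rw [List.dropLast_concat, Finset.mem_range]
        omega

theorem lrmSource_pos (l : List ℕ) (hl : ∀ x ∈ l, 0 < x) : 0 < lrmSource l := by
  rw [lrmSource_eq]
  exact lrmFrom_pos 0 l hl

theorem isFixedSizeSource_lrmSource : IsFixedSizeSource lrmSource where
  nonneg l hl := (lrmSource_pos l hl).le
  le_one l hl := by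
    rw [lrmSource_eq]
    exact lrmFrom_le_one 0 l hl
  sum_eq_one m := by
    simp only [lrmSource_eq]
    rw [sum_composition m (lrmFrom 0), sum_lrmFrom]

theorem isMonotonic_lrmSource : IsMonotonic lrmSource where
  component a b m ha hb hm := by
    simp only [lrmSource_eq, lrmFrom_append, lrmFrom]
    refine mul_le_mul_of_nonneg_left ?_ (lrmFrom_pos 0 a ha).le
    have h0 : (0 : ℝ) < ((0 + a.sum + m : ℕ) : ℝ) := by
      exact_mod_cast (by omega : 0 < 0 + a.sum + m)
    exact mul_le_mul (one_div_le_one_div_of_le h0 (by exact_mod_cast (by omega)))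
      (lrmFrom_anti (by omega) b hb) (lrmFrom_pos _ b hb).le (one_div_nonneg.2 h0.le)
  insert_one a b ha hb := by
    simp only [lrmSource_eq, lrmFrom_append, lrmFrom]
    refine mul_le_mul_of_nonneg_left ?_ (lrmFrom_pos 0 a ha).le
    -- The inserted part contributes a factor at most `1`; what remains is the shift of the offset
    -- by one.
    refine (mul_le_of_le_one_left (lrmFrom_pos _ b hb).le (one_div_natCast_le_one _)).trans ?_
    exact lrmFrom_anti (by omega) b hb
  submul a b ha hb := by
    simp only [lrmSource_eq, lrmFrom_append]
    exact mul_le_mul_of_nonneg_left (lrmFrom_anti (by omega) b hb) (lrmFrom_pos 0 a ha).le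

/-! ## The length of the hypersuccinct code -/

theorem skeletonForest_eq (l : List TopTree) :
    skeletonForest l = l.map TopTree.skeleton := by
  induction l with
  | nil => rfl
  | cons c l ih => simp [skeletonForest, ih]

theorem microTreesForest_eq (l : List TopTree) :
    microTreesForest l = l.flatMap TopTree.microTrees := by
  induction l with
  | nil => rfl
  | cons c l ih => simp [microTreesForest, ih]

theorem size_skeleton (c : TopTree) : c.skeleton.size = c.microTrees.length := by
  refine TopTree.rec (motive_1 := fun c => c.skeleton.size = c.microTrees.length)
    (motive_2 := fun l => ((skeletonForest l).map OrdTree.size).sum = (microTreesForest l).length)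
    ?_ rfl ?_ c
  · intro s q e cs ih
    rw [TopTree.skeleton, TopTree.microTrees, OrdTree.size_node, ih, List.length_cons, add_comm]
  · intro c l h1 h2
    simp [skeletonForest, microTreesForest, h1, h2]

theorem size_node_skeletonForest (l : List TopTree) :
    (OrdTree.node (skeletonForest l)).size = 1 + (microTreesForest l).length := by
  rw [OrdTree.size_node, skeletonForest_eq, microTreesForest_eq, List.length_flatMap, List.map_map]
  congr 3
  funext c
  exact size_skeleton c

theorem sum_le_card_mul {α : Type} (l : List α) (f : α → ℕ) (k : ℕ) (h : ∀ a ∈ l, f a ≤ k) :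
    (l.map f).sum ≤ l.length * k := by
  have := List.sum_le_card_nsmul (l.map f) k (by
    intro x hx
    obtain ⟨a, ha, rfl⟩ := List.mem_map.1 hx
    exact h a ha)
  simpa using this

/-- The shapes of the micro trees of a tree in depth-first order. -/
def microShapes (B : ℕ) (t : OrdTree) : List OrdTree :=
  (microTreesForest (topTier B t)).map MicroTree.shape

theorem coe_microShapes (B : ℕ) (t : OrdTree) :
    (microShapes B t : Multiset OrdTree) = topShapes (cover B t).close := by
  rw [microShapes, ← topShapes, topTier, topShapes_labelGroup]

theorem size_le_of_mem_microShapes {B : ℕ} (hB : 1 ≤ B) (t s : OrdTree) (h : s ∈ microShapes B t) :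
    s.size ≤ 2 * B := by
  rw [← Multiset.mem_coe, coe_microShapes] at h
  exact size_le_of_mem_close (size_le_of_mem_shapes hB t) h

theorem length_dedup_microShapes_le {B : ℕ} (hB : 1 ≤ B) (t : OrdTree) :
    (microShapes B t).dedup.length ≤ 2 ^ (4 * B + 1) := by
  rw [← List.card_toFinset]
  refine (OrdTree.card_le_of_size_le _ (2 * B) fun s hs =>
    size_le_of_mem_microShapes hB t s (List.mem_toFinset.1 hs)).trans_eq ?_
  ring

/-- Per micro tree `8 = 2 + 2 + 1 + 3`: the gamma code of their number, `BP` of the top tier, the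
flag bit and the edge type. A table entry for a shape of `k ≤ 2 * B` nodes takes at most `16 * k +
8` bits, and two more come from the gamma code of the number of entries. -/
theorem length_encodeWith_le {B : ℕ} (hB : 1 ≤ B) (μ : ℕ) (t : OrdTree) :
    (encodeWith B μ t).length ≤
      ((microShapes B t).map fun s => (huffmanCode (microShapes B t) s).length).sum +
        (2 * Nat.log 2 t.size + 5 + (microShapes B t).length * (8 + 2 * Nat.clog 2 (μ + 1)) +
          (microShapes B t).dedup.length * (32 * B + 10)) := by
  have hm : (microTreesForest (topTier B t)).length = (microShapes B t).length := by
    simp [microShapes]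
  have h1 := length_eliasGamma_le t.size
  have h2 := length_eliasGamma_le_two_mul (microShapes B t).length
  have h3 := length_eliasGamma_le_two_mul (microShapes B t).dedup.length
  have h4 := sum_le_card_mul (microShapes B t).dedup (fun s =>
    (eliasGamma (lengthRestricted (huffmanCode (microShapes B t)) s).length ++
      lengthRestricted (huffmanCode (microShapes B t)) s ++ eliasGamma s.size ++ s.bp).length)
    (32 * B + 8) (by
      intro s hs
      have g0 := size_le_of_mem_microShapes hB t s (List.mem_dedup.1 hs)
      have g1 := length_lengthRestricted_le (huffmanCode (microShapes B t)) s
      have g2 := length_eliasGamma_le_two_mul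
        (lengthRestricted (huffmanCode (microShapes B t)) s).length
      have g3 := length_eliasGamma_le_two_mul s.size
      simp only [List.length_append, OrdTree.length_bp]
      omega)
  have h5 : ((microShapes B t).map fun s =>
      (lengthRestricted (huffmanCode (microShapes B t)) s).length).sum ≤
      ((microShapes B t).map fun s => (huffmanCode (microShapes B t) s).length).sum +
        (microShapes B t).length := by
    have := List.sum_le_sum (l := microShapes B t)
      fun s _ => length_lengthRestricted_le_succ (huffmanCode (microShapes B t)) s
    rw [List.sum_map_add] at this
    simpa using this
  have h6 : (encodeWith B μ t).length =
      (eliasGamma t.size).length + (eliasGamma (microShapes B t).length).length +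
      2 * (1 + (microShapes B t).length) +
      ((eliasGamma (microShapes B t).dedup.length).length +
        ((microShapes B t).dedup.map fun s =>
          (eliasGamma (lengthRestricted (huffmanCode (microShapes B t)) s).length ++
            lengthRestricted (huffmanCode (microShapes B t)) s ++
            eliasGamma s.size ++ s.bp).length).sum) +
      ((microShapes B t).map fun s =>
        (lengthRestricted (huffmanCode (microShapes B t)) s).length).sum +
      (microShapes B t).length * (2 * Nat.clog 2 (μ + 1)) + (microShapes B t).length * 3 := by
    simp only [encodeWith, List.length_append, OrdTree.length_bp, size_node_skeletonForest,
      List.length_flatMap, length_fixedWidth, hm, ← microShapes.eq_def, List.map_const',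
      List.sum_replicate, smul_eq_mul, ← two_mul]
  rw [h6]
  nlinarith

theorem treeProb_le_one {p : List ℕ → ℝ} (hs : IsFixedSizeSource p) (t : OrdTree) :
    treeProb p t ≤ 1 := by
  simpa using sum_treeProb_le_one hs t.size {t} (by simp)

theorem logb_prod_map {l : List OrdTree} {f : OrdTree → ℝ} (h : ∀ s ∈ l, f s ≠ 0) :
    Real.logb 2 (l.map f).prod = (l.map fun s => Real.logb 2 (f s)).sum := by
  induction l with
  | nil => simp
  | cons s l ih =>
    have h' : ∀ s ∈ l, f s ≠ 0 := fun s hs => h s (by simp [hs])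
    rw [List.map_cons, List.prod_cons, Real.logb_mul (h s (by simp)), ih h', List.map_cons,
      List.sum_cons]
    refine List.prod_ne_zero fun h0 => ?_
    obtain ⟨s, hs, h0⟩ := List.mem_map.1 h0
    exact h' s hs h0

/-- The Huffman codewords of trees of bounded size are, up to `O(1)` bits each and the logarithm of
the size bound, as short as the information content with respect to any source. -/
theorem sum_length_huffmanCode_le_logb {p : List ℕ → ℝ} (hs : IsFixedSizeSource p) {K : ℕ}
    (hK : 1 ≤ K) (l : List OrdTree) (hl : ∀ s ∈ l, s.size ≤ K) (hpos : ∀ s ∈ l, 0 < treeProb p s) :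
    (((l.map fun s => (huffmanCode l s).length).sum : ℕ) : ℝ) ≤
      -Real.logb 2 (l.map (treeProb p)).prod + l.length * (Real.logb 2 K + 1) := by
  have hK0 : (0 : ℝ) < K := by exact_mod_cast hK
  -- Trees with at most `K` nodes have total probability at most `K`, so division by `K` gives a
  -- subprobability whose rounded-up ideal lengths satisfy the Kraft inequality.
  set len : OrdTree → ℕ := fun s => ⌈Real.logb 2 (K / treeProb p s)⌉₊ with hlen
  have hkraft : (l.dedup.map fun s => ((2 : ℝ) ^ len s)⁻¹).sum ≤ 1 := by
    have h1 : (l.dedup.map fun s => ((2 : ℝ) ^ len s)⁻¹).sum ≤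
        (l.dedup.map fun s => treeProb p s / K).sum := by
      refine List.sum_le_sum fun s hs => ?_
      have hp := hpos s (List.mem_dedup.1 hs)
      have h2 : (K : ℝ) / treeProb p s ≤ 2 ^ len s := by
        rw [← Real.rpow_natCast, ← Real.logb_le_iff_le_rpow one_lt_two (div_pos hK0 hp)]
        exact Nat.le_ceil _
      rw [← inv_div]
      exact inv_anti₀ (div_pos hK0 hp) h2
    refine h1.trans ?_
    rw [← List.sum_toFinset _ l.nodup_dedup, ← Finset.sum_div, div_le_one hK0]
    exact sum_treeProb_le hs K _ fun s hs => hl s (by simpa using hs)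
  have h1 : (((l.map fun s => (huffmanCode l s).length).sum : ℕ) : ℝ) ≤ ((l.map len).sum : ℕ) := by
    exact_mod_cast sum_length_huffmanCode_le l len hkraft
  refine h1.trans ?_
  have h2 : (((l.map len).sum : ℕ) : ℝ) ≤
      (l.map fun s => (Real.logb 2 K + 1) - Real.logb 2 (treeProb p s)).sum := by
    rw [Nat.cast_list_sum, List.map_map]
    refine List.sum_le_sum fun s hs' => ?_
    have hp := hpos s hs'
    have hge : 0 ≤ Real.logb 2 (K / treeProb p s) := by
      refine Real.logb_nonneg one_lt_two ((one_le_div hp).2 ?_)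
      exact (treeProb_le_one hs s).trans (by exact_mod_cast hK)
    have := (Nat.ceil_lt_add_one hge).le
    simp only [Function.comp_apply, hlen]
    rw [Real.logb_div hK0.ne' hp.ne'] at this ⊢
    linarith
  refine h2.trans (le_of_eq ?_)
  rw [logb_prod_map fun s hs => (hpos s hs).ne']
  have h3 : ∀ (c : ℝ) (l : List OrdTree) (f : OrdTree → ℝ),
      (l.map fun s => c - f s).sum = -(l.map f).sum + l.length * c := by
    intro c l f
    induction l with
    | nil => simp
    | cons s l ih =>
      simp only [List.map_cons, List.sum_cons, ih, List.length_cons]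
      push_cast
      ring
  exact h3 _ _ _

theorem length_encodeWith_le_logb {p : List ℕ → ℝ} (hs : IsFixedSizeSource p) (hp : IsMonotonic p)
    {B : ℕ} (hB : 2 ≤ B) (μ : ℕ) (t : OrdTree) (ht : B ≤ t.size) (hpos : 0 < treeProb p t) :
    ((encodeWith B μ t).length : ℝ) ≤ Real.logb 2 (1 / treeProb p t) +
      (2 * Nat.log 2 t.size + 5 + 9 * t.size / B *
        (9 + Real.logb 2 (2 * B) + 2 * Nat.clog 2 (μ + 1)) + 2 ^ (4 * B + 1) * (32 * B + 10)) := by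
  have hB0 : (0 : ℝ) < B := by exact_mod_cast (by omega : 0 < B)
  have hB1 : 1 ≤ B := by omega
  have hle : treeProb p t ≤ ((microShapes B t).map (treeProb p)).prod := by
    have := treeProb_le_shapesProb hs hp B t
    rwa [← coe_microShapes, shapesProb, Multiset.map_coe, Multiset.prod_coe] at this
  -- A shape of probability zero would make the product zero, although it bounds `treeProb p t > 0`
  -- from above.
  have hpos' : ∀ s ∈ microShapes B t, 0 < treeProb p s := by
    intro s hs'
    refine (treeProb_nonneg hs s).lt_of_ne fun h0 => ?_
    rw [List.prod_eq_zero (List.mem_map.2 ⟨s, hs', h0.symm⟩)] at hle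
    linarith
  have h1 := sum_length_huffmanCode_le_logb hs (by omega : 1 ≤ 2 * B) (microShapes B t)
    (size_le_of_mem_microShapes hB1 t) hpos'
  have h2 : Real.logb 2 (treeProb p t) ≤ Real.logb 2 ((microShapes B t).map (treeProb p)).prod :=
    Real.logb_le_logb_of_le one_lt_two hpos hle
  have h3 : ((encodeWith B μ t).length : ℝ) ≤ _ :=
    Nat.cast_le.2 (length_encodeWith_le hB1 μ t)
  have h4 : ((microShapes B t).length : ℝ) ≤ 9 * t.size / B := by
    have := mul_card_topShapes_le hB t ht
    rw [← coe_microShapes, Multiset.coe_card] at this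
    rw [le_div_iff₀ hB0, mul_comm]
    exact_mod_cast this
  have h5 : ((microShapes B t).dedup.length : ℝ) ≤ 2 ^ (4 * B + 1) := by
    exact_mod_cast length_dedup_microShapes_le hB1 t
  have h6 : 0 ≤ Real.logb 2 (2 * B) :=
    Real.logb_nonneg one_lt_two (by exact_mod_cast (by omega : 1 ≤ 2 * B))
  have h7 : ((microShapes B t).length : ℝ) *
      (9 + Real.logb 2 (2 * B) + 2 * Nat.clog 2 (μ + 1)) ≤ _ :=
    mul_le_mul_of_nonneg_right h4 (by positivity)
  have h8 : ((microShapes B t).dedup.length : ℝ) * (32 * B + 10) ≤ _ :=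
    mul_le_mul_of_nonneg_right h5 (by positivity)
  rw [one_div, Real.logb_inv]
  push_cast at h1 h3
  linarith

/-! ## The redundancy -/

/-- A bound on the redundancy of the hypersuccinct code in terms of the number of nodes. -/
noncomputable def redundancy (n : ℕ) : ℝ :=
  2 * Real.logb 2 n + 5 +
    72 * n / Real.logb 2 n * (11 + 3 * Real.logb 2 (Real.logb 2 n)) +
    32 * √n * (4 * Real.logb 2 n + 42)

theorem length_hypersuccinct_le {p : List ℕ → ℝ} (hs : IsFixedSizeSource p) (hp : IsMonotonic p)
    (t : OrdTree) (ht : 256 < t.size) (hpos : 0 < treeProb p t) :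
    ((hypersuccinct t).length : ℝ) ≤ Real.logb 2 (1 / treeProb p t) + redundancy t.size := by
  set n := t.size with hn
  have hn0 : (0 : ℝ) < n := by exact_mod_cast (by omega : 0 < n)
  set L := Real.logb 2 n with hL
  -- This forces `B ≥ 2`, as the count of micro trees requires, and absorbs the roundings below: `2
  -- * B ≤ L / 4 + 2 ≤ L`.
  have hL8 : 8 < L := by
    rw [hL, Real.lt_logb_iff_rpow_lt one_lt_two hn0]
    norm_num
    exact_mod_cast ht
  set B := ⌈L / 8⌉₊ with hBdef
  set μ := ⌈L / 4⌉₊ with hμdef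
  have hBlo : L / 8 ≤ B := Nat.le_ceil _
  have hBhi : (B : ℝ) ≤ L / 8 + 1 := (Nat.ceil_lt_add_one (by linarith)).le
  have hμhi : (μ : ℝ) ≤ L / 4 + 1 := (Nat.ceil_lt_add_one (by linarith)).le
  have hB2 : 2 ≤ B := by
    have : (1 : ℝ) < B := by linarith
    exact_mod_cast this
  have hB0 : (0 : ℝ) < B := by linarith
  have hpowL : (2 : ℝ) ^ L = n := Real.rpow_logb two_pos (by norm_num) hn0
  have hLn : L ≤ n := by
    rw [hL, Real.logb_le_iff_le_rpow one_lt_two hn0, Real.rpow_natCast]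
    exact_mod_cast (Nat.lt_two_pow_self).le
  have hBn : B ≤ n := Nat.ceil_le.2 (by linarith)
  have h := length_encodeWith_le_logb hs hp hB2 μ t hBn hpos
  refine h.trans ?_
  rw [← hn]
  have h1 : (Nat.log 2 n : ℝ) ≤ L := Real.natLog_le_logb n 2
  have h2 : 9 * (n : ℝ) / B ≤ 72 * n / L := by
    rw [div_le_div_iff₀ hB0 (by linarith)]
    nlinarith
  have h3 : Real.logb 2 (2 * B) ≤ Real.logb 2 L :=
    Real.logb_le_logb_of_le one_lt_two (by linarith) (by linarith)
  have h3' : 0 ≤ Real.logb 2 (2 * B) := Real.logb_nonneg one_lt_two (by linarith)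
  -- The exponent one below the ceiling has a power less than `μ + 1 ≤ L / 4 + 2 ≤ L`.
  have h4 : (Nat.clog 2 (μ + 1) : ℝ) ≤ Real.logb 2 L + 1 := by
    have hlt : 2 ^ (Nat.clog 2 (μ + 1)).pred < μ + 1 :=
      Nat.pow_pred_clog_lt_self one_lt_two (by
        have : 0 < μ := Nat.ceil_pos.2 (by linarith)
        omega)
    have h5 : ((Nat.clog 2 (μ + 1)).pred : ℝ) ≤ Real.logb 2 L := by
      rw [Real.le_logb_iff_rpow_le one_lt_two (by linarith), Real.rpow_natCast]
      have : (2 : ℝ) ^ (Nat.clog 2 (μ + 1)).pred < μ + 1 := by exact_mod_cast hlt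
      linarith
    have h6 : (Nat.clog 2 (μ + 1) : ℝ) ≤ ((Nat.clog 2 (μ + 1)).pred : ℝ) + 1 := by
      exact_mod_cast (by rw [Nat.pred_eq_sub_one]; omega)
    linarith
  -- `4 * B + 1 ≤ L / 2 + 5`, where `2 ^ (L / 2) = √n` and `2 ^ 5 = 32`. The choice `B ≈ L / 8` is
  -- what keeps the table sublinear.
  have h5 : (2 : ℝ) ^ (4 * B + 1) ≤ 32 * √n := by
    have : (2 : ℝ) ^ (4 * B + 1) = 2 ^ (4 * (B : ℝ) + 1) := by
      rw [← Real.rpow_natCast]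
      push_cast
      rfl
    rw [this]
    calc (2 : ℝ) ^ (4 * (B : ℝ) + 1) ≤ 2 ^ (L * (1 / 2) + 5) :=
          Real.rpow_le_rpow_of_exponent_le one_le_two (by linarith)
      _ = 32 * √n := by
          rw [Real.rpow_add two_pos, Real.rpow_mul two_pos.le, hpowL, ← Real.sqrt_eq_rpow]
          norm_num
          ring
  have h6 : 9 * (n : ℝ) / B * (9 + Real.logb 2 (2 * B) + 2 * Nat.clog 2 (μ + 1)) ≤
      72 * n / L * (11 + 3 * Real.logb 2 L) :=
    mul_le_mul h2 (by linarith) (by positivity) (div_nonneg (by positivity) (by linarith))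
  have h7 : (2 : ℝ) ^ (4 * B + 1) * (32 * B + 10) ≤ 32 * √n * (4 * L + 42) :=
    mul_le_mul h5 (by linarith) (by positivity) (by positivity)
  rw [redundancy]
  linarith

theorem redundancy_isBigO : redundancy =O[Filter.atTop]
    fun n : ℕ => (n : ℝ) * Real.log (Real.log (n : ℝ)) / Real.log (n : ℝ) := by
  have hlog : Filter.Tendsto (fun n : ℕ => Real.log (Real.log (n : ℝ))) Filter.atTop
      Filter.atTop :=
    Real.tendsto_log_atTop.comp (Real.tendsto_log_atTop.comp tendsto_natCast_atTop_atTop)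
  -- The estimates below add up to `1656 + 16 * (1600 + 9) = 27400`.
  refine Asymptotics.IsBigO.of_bound 30000 ?_
  filter_upwards [hlog.eventually_ge_atTop 1, Filter.eventually_ge_atTop 3] with n hb hn
  have hn3 : (3 : ℝ) ≤ n := by exact_mod_cast hn
  set a := Real.log (n : ℝ) with ha
  set b := Real.log a with hbdef
  have ha1 : 1 ≤ a := by
    by_contra hlt
    have ha0 : 0 ≤ a := Real.log_natCast_nonneg n
    have : b ≤ 0 := Real.log_nonpos ha0 (not_le.1 hlt).le
    linarith
  have hl2 : 1 / 2 < Real.log 2 := by have := Real.log_two_gt_d9; linarith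
  have hl2' : Real.log 2 < 1 := by have := Real.log_two_lt_d9; linarith
  have hl0 : 0 < Real.log 2 := by linarith
  set L := Real.logb 2 (n : ℝ) with hL
  have hLa : L = a / Real.log 2 := rfl
  have hL1 : a ≤ L := by
    rw [hLa, le_div_iff₀ hl0]
    nlinarith
  have hL2 : L ≤ 2 * a := by
    rw [hLa, div_le_iff₀ hl0]
    nlinarith
  -- `log L ≤ log 2 + b ≤ 2 * b` since `b ≥ 1`, and dividing by `log 2 > 1 / 2` at most doubles
  -- this.
  have hlgL : Real.logb 2 L ≤ 4 * b := by
    have h1 : Real.log L ≤ Real.log 2 + b := by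
      rw [hbdef, ← Real.log_mul two_ne_zero (by linarith)]
      exact Real.log_le_log (by linarith) hL2
    rw [Real.logb, div_le_iff₀ hl0]
    nlinarith
  have hlgL0 : 0 ≤ Real.logb 2 L := Real.logb_nonneg one_lt_two (by linarith)
  have hsqrt1 : 1 ≤ √(n : ℝ) := Real.one_le_sqrt.2 (by linarith)
  have hsq : √(n : ℝ) * √(n : ℝ) = n := Real.mul_self_sqrt (by linarith)
  -- From `log n ≤ 4 * n ^ (1 / 4)`; hence `√n * log n` is `O(n / log n)`.
  have hasq : a * a ≤ 16 * √(n : ℝ) := by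
    have h1 : a ≤ (n : ℝ) ^ (1 / 4 : ℝ) / (1 / 4) :=
      Real.log_le_rpow_div (by linarith) (by norm_num)
    have h2 : (n : ℝ) ^ (1 / 4 : ℝ) * (n : ℝ) ^ (1 / 4 : ℝ) = √(n : ℝ) := by
      rw [← Real.rpow_add (by linarith), Real.sqrt_eq_rpow]
      norm_num
    rw [← h2]
    nlinarith
  have hna : √(n : ℝ) * a ≤ 16 * (n / a) := by
    rw [← mul_div_assoc, le_div_iff₀ (by linarith)]
    nlinarith
  have hnab : (n : ℝ) / a ≤ n * b / a :=
    div_le_div_of_nonneg_right (by nlinarith) (by linarith)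
  have hnL : 72 * (n : ℝ) / L * (11 + 3 * Real.logb 2 L) ≤ 1656 * (n * b / a) := by
    calc 72 * (n : ℝ) / L * (11 + 3 * Real.logb 2 L) ≤ 72 * n / a * (23 * b) :=
          mul_le_mul (div_le_div_of_nonneg_left (by positivity) (by linarith) hL1) (by linarith)
            (by positivity) (by positivity)
      _ = 1656 * (n * b / a) := by ring
  have hs1 : 32 * √(n : ℝ) * (4 * L + 42) ≤ 1600 * (√(n : ℝ) * a) := by nlinarith
  have hs2 : 2 * L + 5 ≤ 9 * (√(n : ℝ) * a) := by nlinarith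
  have hnn : 0 ≤ redundancy n := by
    have : 0 ≤ L := by linarith
    rw [redundancy]
    positivity
  have hR : redundancy n = 2 * L + 5 + 72 * n / L * (11 + 3 * Real.logb 2 L) +
    32 * √n * (4 * L + 42) := rfl
  have hg : 0 ≤ (n : ℝ) * b / a := by positivity
  rw [Real.norm_of_nonneg hnn, Real.norm_of_nonneg hg, hR]
  linarith

/-- The total length of the codes of all trees with `n` nodes. -/
noncomputable def totalLength (n : ℕ) : ℕ :=
  ∑ t ∈ (OrdTree.finite_size_eq n).toFinset, (hypersuccinct t).length

theorem length_hypersuccinct_le_totalLength (t : OrdTree) :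
    (hypersuccinct t).length ≤ totalLength t.size :=
  Finset.single_le_sum (f := fun t => (hypersuccinct t).length) (fun _ _ => Nat.zero_le _)
    (by simp)

theorem exists_redundancy : ∃ r : ℕ → ℝ,
    (r =O[Filter.atTop]
      fun n : ℕ => (n : ℝ) * Real.log (Real.log (n : ℝ)) / Real.log (n : ℝ)) ∧
    ∀ p : List ℕ → ℝ, IsFixedSizeSource p → IsMonotonic p → ∀ (n : ℕ) (t : OrdTree), t.size = n →
      0 < treeProb p t →
        ((hypersuccinct t).length : ℝ) ≤ Real.logb 2 (1 / treeProb p t) + r n := by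
  -- For each of the finitely many small `n` there are finitely many trees, so their total code
  -- length is a bound independent of the source.
  refine ⟨fun n => if 256 < n then redundancy n else totalLength n, ?_, ?_⟩
  · refine redundancy_isBigO.congr' ?_ Filter.EventuallyEq.rfl
    filter_upwards [Filter.eventually_gt_atTop 256] with n hn
    rw [if_pos hn]
  · rintro p hs hp n t rfl hpos
    dsimp only
    split_ifs with hn
    · exact length_hypersuccinct_le hs hp t hn hpos
    · have h1 : ((hypersuccinct t).length : ℝ) ≤ totalLength t.size := by
        exact_mod_cast length_hypersuccinct_le_totalLength t
      have h2 : 0 ≤ Real.logb 2 (1 / treeProb p t) :=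
        Real.logb_nonneg one_lt_two ((one_le_div hpos).2 (treeProb_le_one hs t))
      linarith

end Hypersuccinct

theorem mainTheorem11 :
    (∃ r : ℕ → ℝ,
      Asymptotics.IsBigO Filter.atTop r
        (fun n : ℕ => (n : ℝ) * Real.log (Real.log (n : ℝ)) / Real.log (n : ℝ)) ∧
      (∀ p : List ℕ → ℝ,
        Hypersuccinct.IsFixedSizeSource p → Hypersuccinct.IsMonotonic p →
        ∀ (n : ℕ) (t : Hypersuccinct.OrdTree), t.size = n → 0 < Hypersuccinct.treeProb p t →
          ((Hypersuccinct.hypersuccinct t).length : ℝ) ≤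
            Real.logb 2 (1 / Hypersuccinct.treeProb p t) + r n) ∧
      (∀ (n : ℕ) (t : Hypersuccinct.OrdTree), t.size = n →
        0 < Hypersuccinct.treeProb Hypersuccinct.uniformComposition t ∧
          ((Hypersuccinct.hypersuccinct t).length : ℝ) ≤
            Real.logb 2 (1 / Hypersuccinct.treeProb Hypersuccinct.uniformComposition t) + r n) ∧
      (∀ (n : ℕ) (t : Hypersuccinct.OrdTree), t.size = n →
        0 < Hypersuccinct.treeProb Hypersuccinct.lrmSource t ∧
          ((Hypersuccinct.hypersuccinct t).length : ℝ) ≤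
            Real.logb 2 (1 / Hypersuccinct.treeProb Hypersuccinct.lrmSource t) + r n)) ∧
    (Hypersuccinct.IsFixedSizeSource Hypersuccinct.uniformComposition ∧
      Hypersuccinct.IsMonotonic Hypersuccinct.uniformComposition) ∧
    (Hypersuccinct.IsFixedSizeSource Hypersuccinct.lrmSource ∧
      Hypersuccinct.IsMonotonic Hypersuccinct.lrmSource) := by
  obtain ⟨r, hr, hbound⟩ := Hypersuccinct.exists_redundancy
  have hu := Hypersuccinct.isFixedSizeSource_uniformComposition
  have hu' := Hypersuccinct.isMonotonic_uniformComposition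
  have hl := Hypersuccinct.isFixedSizeSource_lrmSource
  have hl' := Hypersuccinct.isMonotonic_lrmSource
  refine ⟨⟨r, hr, hbound, fun n t ht => ?_, fun n t ht => ?_⟩, ⟨hu, hu'⟩, ⟨hl, hl'⟩⟩
  · have hpos := Hypersuccinct.treeProb_pos
      (fun l _ => Hypersuccinct.uniformComposition_pos l) t
    exact ⟨hpos, hbound _ hu hu' n t ht hpos⟩
  · have hpos := Hypersuccinct.treeProb_pos Hypersuccinct.lrmSource_pos t
    exact ⟨hpos, hbound _ hl hl' n t ht hpos⟩
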